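/- **Conventions.** Let $\mathcal H=\{\operatorname{Re} z>0\}$ and, for $R>0$, $Q_R=\{0<\operatorname{Re} z<2R,\ -R<\operatorname{Im} z<R\}$. A *tract model* $(\tau,\Omega)$ is an unbounded simply connected domain $\Omega\subset\mathbb C$ with a conformal isomorphism $\tau:\Omega\to\mathcal H$ whose inverse $\varphi=\tau^{-1}$ satisfies $|\varphi(z)|\to\infty$ as $z\to\infty$ in $\mathcal H$. Put $\Omega_R=\varphi(Q_R)$ and $\varphi_R(z)=\varphi(Rz)$. The tract is *Hölder* if there are $H>0$ and $0<\alpha\le 1$ such that for every $\kappa\in(0,1)$ there are $m>0$ and $R_0\ge 1$ such that for all $R\ge R_0$: 1. $|\varphi_R(z_1)-\varphi_R(z_2)|\le H\,|\varphi_R'(1)|\,|z_1-z_2|^{\alpha}$ for all $z_1,z_2\in Q_1$; 2. $|\varphi_R(z)|\ge m\operatorname{diam}(\Omega_R)$ for all $z\in Q_1\setminus Q_\kappa$. With $g_R=\varphi_R/\operatorname{diam}(\Omega_R)$ and $\kappa=1/(1+2\pi)$, put for $t\ge 0$ $$I_R(t)=\max\Big\{\int_{-1}^{-\kappa}|g_R'(\tfrac1R+iy)|^t\,dy,\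 \int_{\kappa}^{1}|g_R'(\tfrac1R+iy)|^t\,dy\Big\},\qquad \beta_\infty(t)=\limsup_{R\to\infty}\frac{\log I_R(t)}{\log R}.$$ A *logarithmic tract over infinity* of a meromorphic function $f$ is an unbounded simply connected domain $\Omega$ such that for some $R>0$ the restriction $f:\Omega\to\{|z|>R\}$ is a (universal) covering. Then $f=Re^{\tau}$ on $\Omega$ for a conformal isomorphism $\tau:\Omega\to\mathcal H$, unique up to adding an integer multiple of $2\pi i$; the tract is called Hölder if $(\tau,\Omega)$ is a Hölder tract model, and $\beta_\infty$ is formed with $\varphi=\tau^{-1}$. An *expanding repeller* of $f$ is a nonempty compact set $X$ with $f(X)=X$, such that $|(f^n)'|\ge c\rho^n$ on $X$ for all $n\ge0$ with some $c>0$, $\rho>1$, and such that $X$ has an open neighbourhood, on which $f$ is holomorphic, in which $X$ is the set of all points whose entire forward orbit stays in that neighbourhood. For a meromorphic $f:\mathbb C\to\hat{\mathbb C}$, $\operatorname{HypDim}(f)$ is the supremum of the Hausdorff dimensions of the expanding repellers contained in the Julia set of $f$ (the complement of the set of points having a neighbourhood on which all iterates are defined and form a normal family). For a holomorphic $F:\Omega\to\mathbb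 C$, $\operatorname{HypDim}(F)$ is the supremum of the Hausdorff dimensions of the expanding repellers of $F$ in $\Omega$. **Theorem 4.1.** Let $(\tau,\Omega)$ be a Hölder tract model. Then $t\mapsto\beta_\infty(t)-t+1$ has a unique zero $\Theta$ in $[0,\infty)$, and $\Theta\ge 1$. If $f$ is a transcendental meromorphic function for which $\Omega$ is a logarithmic tract over infinity, with $f=Re^{\tau}$ on $\Omega$ and $R>0$ as above, then $$\operatorname{HypDim}(f)\ \ge\ \Theta\ \ge\ 1 .$$ The same holds for the local function $F=e^{\tau}$ on $\Omega$: $\operatorname{HypDim}(F)\ge\Theta\ge1$. -/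

import Mathlib

open Set Filter Topology

noncomputable section

namespace HolderTract

/-- The right half-plane `{Re z > 0}`. -/
def rightHalfPlane : Set ℂ := {z | 0 < z.re}

/-- The square `Q_R = {0 < Re z < 2R, -R < Im z < R}`. -/
def Q (R : ℝ) : Set ℂ := {z | 0 < z.re ∧ z.re < 2 * R ∧ -R < z.im ∧ z.im < R}

/-- `(τ, Ω)` is a tract model: `Ω` is an unbounded simply connected domain, `τ` is a conformal
isomorphism of `Ω` onto the right half-plane with inverse `φ`, and `φ(z) → ∞` as `z → ∞`
in the half-plane. The values of `τ` off `Ω` and of `φ` off the half-plane play no role. -/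
structure IsTractModel (Ω : Set ℂ) (τ φ : ℂ → ℂ) : Prop where
  isOpen : IsOpen Ω
  simplyConnected : SimplyConnectedSpace Ω
  unbounded : ¬ Bornology.IsBounded Ω
  holo : DifferentiableOn ℂ τ Ω
  holo_inv : DifferentiableOn ℂ φ rightHalfPlane
  mapsTo : MapsTo τ Ω rightHalfPlane
  mapsTo_inv : MapsTo φ rightHalfPlane Ω
  left_inv : ∀ z ∈ Ω, φ (τ z) = z
  right_inv : ∀ w ∈ rightHalfPlane, τ (φ w) = w
  proper : Tendsto φ (Bornology.cobounded ℂ ⊓ 𝓟 rightHalfPlane) (Bornology.cobounded ℂ)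

/-- The rescaling `φ_R (z) = φ (R z)`. -/
def rescale (φ : ℂ → ℂ) (R : ℝ) (z : ℂ) : ℂ := φ ((R : ℂ) * z)

/-- The diameter of `Ω_R = φ (Q_R)`. It is only used where this set is bounded. -/
def diamTract (φ : ℂ → ℂ) (R : ℝ) : ℝ := Metric.diam (φ '' Q R)

/-- The tract with inverse Riemann map `φ` is `(H, α)`-Hölder. -/
def IsHolderWith (φ : ℂ → ℂ) (H α : ℝ) : Prop :=
  ∀ κ : ℝ, 0 < κ → κ < 1 → ∃ m : ℝ, 0 < m ∧ ∃ R₀ : ℝ, 1 ≤ R₀ ∧ ∀ R : ℝ, R₀ ≤ R →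
    (∀ z₁ ∈ Q 1, ∀ z₂ ∈ Q 1, ‖rescale φ R z₁ - rescale φ R z₂‖ ≤
      H * ‖deriv (rescale φ R) 1‖ * ‖z₁ - z₂‖ ^ α) ∧
    (∀ z ∈ Q 1 \ Q κ, m * diamTract φ R ≤ ‖rescale φ R z‖)

/-- The tract with inverse Riemann map `φ` is Hölder. -/
def IsHolder (φ : ℂ → ℂ) : Prop :=
  ∃ H α : ℝ, 0 < H ∧ 0 < α ∧ α ≤ 1 ∧ IsHolderWith φ H α

/-- The rescaled Riemann map `g_R (z) = φ (R z) / diam Ω_R`. -/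
def g (φ : ℂ → ℂ) (R : ℝ) (z : ℂ) : ℂ := rescale φ R z / (diamTract φ R : ℂ)

/-- The constant `κ = 1 / (1 + 2π)`. -/
def kappa : ℝ := (1 + 2 * Real.pi)⁻¹

/-- The integral mean of `|g_R'| ^ t` over `{1/R + iy : a < y < b}`. -/
def segMean (φ : ℂ → ℂ) (R t a b : ℝ) : ℝ :=
  ∫ y in a..b, ‖deriv (g φ R) (((1 / R : ℝ) : ℂ) + (y : ℂ) * Complex.I)‖ ^ t

/-- `I_R (t)`: the larger of the means over the upper and over the lower segment. -/
def meanI (φ : ℂ → ℂ) (R t : ℝ) : ℝ :=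
  max (segMean φ R t (-1) (-kappa)) (segMean φ R t kappa 1)

/-- `β_R (t) = log I_R (t) / log R`. -/
def betaR (φ : ℂ → ℂ) (R t : ℝ) : ℝ := Real.log (meanI φ R t) / Real.log R

/-- The integral means spectrum at infinity `β_∞ (t) = limsup_{R → ∞} β_R (t)`,
as an extended real number, so that the upper limit always exists. -/
def betaInf (φ : ℂ → ℂ) (t : ℝ) : EReal :=
  limsup (fun R : ℝ => ((betaR φ R t : ℝ) : EReal)) atTop

/-- The poles of a meromorphic function. -/
def poles (f : ℂ → ℂ) : Set ℂ := {z | meromorphicOrderAt f z < 0}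

/-- `f` is a transcendental meromorphic function on the plane: meromorphic (in normal form, that
is, `f` is analytic off the poles, with the conventional value `0` at the poles) and not a
quotient of two polynomials. -/
def IsTranscendentalMeromorphic (f : ℂ → ℂ) : Prop :=
  MeromorphicNFOn f univ ∧
    ¬ ∃ p q : Polynomial ℂ, q ≠ 0 ∧ ∀ z, q.eval z ≠ 0 → f z = p.eval z / q.eval z

/-- `Ω` is a logarithmic tract of `f` over infinity: an unbounded simply connected domain on which
`f` restricts to a (hence universal) covering of `{|z| > R}`. There is no pole in `Ω`, as the value
at a pole is `0` by convention. -/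
structure IsLogarithmicTract (f : ℂ → ℂ) (Ω : Set ℂ) (R : ℝ) : Prop where
  pos : 0 < R
  isOpen : IsOpen Ω
  simplyConnected : SimplyConnectedSpace Ω
  unbounded : ¬ Bornology.IsBounded Ω
  mapsTo : MapsTo f Ω {w | R < ‖w‖}
  covering : IsCoveringMap mapsTo.restrict

/-- The chordal distance on the Riemann sphere. -/
def chordal : OnePoint ℂ → OnePoint ℂ → ℝ
  | some z, some w => 2 * ‖z - w‖ / (√(1 + ‖z‖ ^ 2) * √(1 + ‖w‖ ^ 2))
  | some z, none => 2 / √(1 + ‖z‖ ^ 2)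
  | none, some w => 2 / √(1 + ‖w‖ ^ 2)
  | none, none => 0

/-- The sequence `F` is a normal family on `U`: each sequence of its members has a subsequence that
converges, for the chordal distance and uniformly on compact subsets of `U`, to a map into the
sphere. -/
def IsNormalOn (F : ℕ → ℂ → ℂ) (U : Set ℂ) : Prop :=
  ∀ s : ℕ → ℕ, ∃ k : ℕ → ℕ, StrictMono k ∧ ∃ G : ℂ → OnePoint ℂ,
    ∀ K : Set ℂ, K ⊆ U → IsCompact K → ∀ ε : ℝ, 0 < ε →
      ∀ᶠ j in atTop, ∀ z ∈ K, chordal (F (s (k j)) z : OnePoint ℂ) (G z) < ε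

/-- The Fatou set: points with a neighbourhood on which all iterates are defined (no orbit meets
a pole) and form a normal family. -/
def fatou (f : ℂ → ℂ) : Set ℂ :=
  {z | ∃ U : Set ℂ, IsOpen U ∧ z ∈ U ∧ (∀ w ∈ U, ∀ n : ℕ, f^[n] w ∉ poles f) ∧
    IsNormalOn (fun n => f^[n]) U}

/-- The Julia set (in the plane). -/
def julia (f : ℂ → ℂ) : Set ℂ := (fatou f)ᶜ

/-- `X` is an expanding repeller of `f`, where `f` is holomorphic on the open set `D`: a nonempty
compact subset of `D` with `f X = X` on which the derivatives of the iterates grow uniformly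
exponentially, and which is the set of all points whose orbit stays in some neighbourhood of `X`. -/
structure IsExpandingRepeller (f : ℂ → ℂ) (D X : Set ℂ) : Prop where
  isCompact : IsCompact X
  nonempty : X.Nonempty
  image_eq : f '' X = X
  expanding : ∃ c ρ : ℝ, 0 < c ∧ 1 < ρ ∧ ∀ n : ℕ, ∀ z ∈ X, c * ρ ^ n ≤ ‖deriv f^[n] z‖
  isolated : ∃ U : Set ℂ, IsOpen U ∧ X ⊆ U ∧ U ⊆ D ∧ ∀ z, (∀ n : ℕ, f^[n] z ∈ U) → z ∈ X

/-- The hyperbolic dimension of a meromorphic function on the plane. -/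
def hypDim (f : ℂ → ℂ) : ENNReal :=
  ⨆ (X : Set ℂ) (_ : IsExpandingRepeller f (poles f)ᶜ X ∧ X ⊆ julia f), dimH X

/-- The hyperbolic dimension of a local function `F`, holomorphic on the domain `Ω`. Each of its
expanding repellers consists of points whose whole orbit stays in `Ω`. -/
def localHypDim (F : ℂ → ℂ) (Ω : Set ℂ) : ENNReal :=
  ⨆ (X : Set ℂ) (_ : IsExpandingRepeller F Ω X), dimH X

end HolderTract

end

open HolderTract

/-!
The integral means change by at most a fixed power of `R ^ (t' - t)` when `t` grows to `t'`: the
distortion theorem bounds the derivative of `g_R` on the line `Re z = 1/R` from below by a power of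
`R`, and the Hölder property bounds it from above by `R ^ (1 - α / 2)`. Hence `β_∞(t) - t + 1` is
Lipschitz and decreases with slope at most `-α / 2`, so it has a unique zero `Θ`, and `Θ ≥ 1` means
that `β_∞(1) ≥ 0`. If `β_∞(1)` were negative, the relative variation of `φ` along the segments
between the heights `κR` and `R` would be at most a negative power of `R`, hence summable over
geometrically growing scales, and `φ` would stay bounded on a sequence tending to infinity.

For `0 < t < Θ` we have `β_∞(t) > t - 1`. Set `P = R |φ'(R)|`, which is comparable to `diam Ω_R`.
The points `log P + 2πik` with `κR ≤ |2πk| ≤ R` are, up to a bounded error, the preimages under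
`R e^z` of a point of modulus comparable to `P`, and a large integral mean makes
`∑ (|φ'(log P + 2πik)| / P) ^ t` large, the loss in moving from `Re z = 1` to `Re z = log P` being
only a power of `log P`. The values `φ(log P + 2πik) / P` lie in a compact annulus, so a definite
share of the sum comes from indices `k` whose values are close to a common point `C / P`. For these
indices the inverse branches of `f` on a disk around `C` map the disk into itself, contract it, and
have contraction ratios `s k` with `∑ (s k) ^ t ≥ 1`. Their limit set is an expanding repeller of
dimension at least `t`. It lies in the Julia set because the derivatives of the iterates grow
exponentially along bounded orbits.
-/

namespace HolderTract

/-! ### Univalent functions -/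

section Univalent

open Metric Complex

variable {f : ℂ → ℂ} {c w₀ : ℂ} {r M : ℝ}

lemma norm_sub_sub_mul_le_of_convex {s : Set ℂ} {a z : ℂ} (hs : Convex ℝ s)
    (hf : ∀ x ∈ s, DifferentiableAt ℂ f x) (ha : ∀ x ∈ s, ‖deriv f x - a‖ ≤ M) (hc : c ∈ s)
    (hz : z ∈ s) : ‖f z - f c - (z - c) * a‖ ≤ M * ‖z - c‖ := by
  rw [show f z - f c - (z - c) * a = f z - z * a - (f c - c * a) by ring]
  exact hs.norm_image_sub_le_of_norm_hasDerivWithin_le (f := fun x => f x - x * a)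
    (fun x hx => ((hf x hx).hasDerivAt.sub (hasDerivAt_mul_const a)).hasDerivWithinAt) ha hc hz

lemma ball_subset_image_of_norm_deriv_le (hf : DifferentiableOn ℂ f (ball c r)) (hr : 0 < r)
    (h0 : deriv f c ≠ 0) (hM : ∀ z ∈ ball c r, ‖deriv f z‖ ≤ M) :
    ball (f c) (r * ‖deriv f c‖ ^ 2 / (16 * M)) ⊆ f '' ball c r := by
  set A := ‖deriv f c‖
  have hA : 0 < A := norm_pos_iff.2 h0
  have hAM : A ≤ M := hM c (mem_ball_self hr)
  have hM0 : 0 < M := hA.trans_le hAM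
  set s := r * A / (4 * M) with hs
  have hs0 : 0 < s := by positivity
  have hsr : s < r := by
    rw [hs, div_lt_iff₀ (by positivity)]
    nlinarith
  have hsub : closedBall c s ⊆ ball c r := closedBall_subset_ball hsr
  have hderiv : ∀ z ∈ closedBall c s, ‖deriv f z - deriv f c‖ ≤ A / 2 := by
    intro z hz
    have hmaps : MapsTo (deriv f) (ball c r) (closedBall (deriv f c) (2 * M)) := by
      intro x hx
      rw [mem_closedBall, dist_eq_norm]
      linarith [norm_sub_le (deriv f x) (deriv f c), hM x hx]
    rw [← dist_eq_norm]
    calc dist (deriv f z) (deriv f c) ≤ 2 * M / r * dist z c :=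
          dist_le_div_mul_dist_of_mapsTo_ball (hf.deriv isOpen_ball) hmaps (hsub hz)
      _ ≤ 2 * M / r * s := by gcongr; exact hz
      _ = A / 2 := by rw [hs]; field_simp; norm_num
  have hsphere : ∀ z ∈ sphere c s, s * A / 2 ≤ ‖f z - f c‖ := by
    intro z hz
    have hlin : ‖f z - f c - (z - c) * deriv f c‖ ≤ A / 2 * ‖z - c‖ :=
      norm_sub_sub_mul_le_of_convex (convex_closedBall c s)
        (fun x hx => hf.differentiableAt (isOpen_ball.mem_nhds (hsub hx))) hderiv
        (mem_closedBall_self hs0.le) (sphere_subset_closedBall hz)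
    have htri := norm_sub_norm_le ((z - c) * deriv f c) ((z - c) * deriv f c - (f z - f c))
    rw [sub_sub_cancel, norm_mul, norm_sub_rev _ (f z - f c)] at htri
    rw [mem_sphere_iff_norm.1 hz] at hlin htri
    linarith
  have hnonconst : ∃ᶠ z in 𝓝 c, f z ≠ f c :=
    ((hf.hasDerivAt (ball_mem_nhds c hr)).eventually_ne h0).frequently.filter_mono
      nhdsWithin_le_nhds
  have hcover := DiffContOnCl.ball_subset_image_closedBall
    ((hf.mono hsub).diffContOnCl_ball subset_rfl) hs0 hsphere hnonconst
  refine (ball_subset_ball (le_of_eq ?_)).trans (hcover.trans (image_mono hsub))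
  rw [hs]
  field_simp
  norm_num

/-- A weak form of Bloch's theorem: the point where `(r / 2 - |z - c|) |f' z|` is largest is the
centre of a disc on which `|f'|` is at most twice its value at the centre. -/
lemma exists_ball_subset_image (hf : DifferentiableOn ℂ f (ball c r)) (hr : 0 < r)
    (h0 : deriv f c ≠ 0) : ∃ w, ball w (r * ‖deriv f c‖ / 128) ⊆ f '' ball c r := by
  have hcont : ContinuousOn (fun z => (r / 2 - dist z c) * ‖deriv f z‖) (closedBall c (r / 2)) :=
    ContinuousOn.mul (by fun_prop) ((hf.deriv isOpen_ball).continuousOn.mono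
      (closedBall_subset_ball (half_lt_self hr))).norm
  obtain ⟨z₀, -, hmax⟩ := (isCompact_closedBall c (r / 2)).exists_isMaxOn
    (nonempty_closedBall.2 (half_pos hr).le) hcont
  set A := ‖deriv f z₀‖
  set s := (r / 2 - dist z₀ c) / 2 with hs
  have hmax' : ∀ z ∈ closedBall c (r / 2), (r / 2 - dist z c) * ‖deriv f z‖ ≤ 2 * s * A := by
    intro z hz
    calc (r / 2 - dist z c) * ‖deriv f z‖ ≤ (r / 2 - dist z₀ c) * A := hmax hz
      _ = 2 * s * A := by rw [hs]; ring
  have hsA : r * ‖deriv f c‖ ≤ 4 * (s * A) := by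
    have := hmax' c (mem_closedBall_self (half_pos hr).le)
    rw [dist_self] at this
    linarith
  have hsA0 : 0 < s * A := by
    have := mul_pos hr (norm_pos_iff.2 h0)
    linarith
  have hs0 : 0 < s := pos_of_mul_pos_left hsA0 (norm_nonneg _)
  have hA0 : 0 < A := pos_of_mul_pos_right hsA0 hs0.le
  have hdist : ∀ z ∈ ball z₀ s, s ≤ r / 2 - dist z c := by
    intro z hz
    linarith [dist_triangle z z₀ c, mem_ball.1 hz]
  have hsub : ball z₀ s ⊆ ball c r := fun z hz => by
    rw [mem_ball]
    linarith [hdist z hz]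
  have hderiv : ∀ z ∈ ball z₀ s, ‖deriv f z‖ ≤ 2 * A := by
    intro z hz
    have hz' : z ∈ closedBall c (r / 2) := by
      rw [mem_closedBall]
      linarith [hdist z hz]
    refine le_of_mul_le_mul_left ?_ hs0
    calc s * ‖deriv f z‖ ≤ (r / 2 - dist z c) * ‖deriv f z‖ := by gcongr; exact hdist z hz
      _ ≤ 2 * s * A := hmax' z hz'
      _ = s * (2 * A) := by ring
  have hcover := ball_subset_image_of_norm_deriv_le (hf.mono hsub) hs0 (norm_pos_iff.1 hA0) hderiv
  refine ⟨f z₀, (ball_subset_ball ?_).trans (hcover.trans (image_mono hsub))⟩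
  calc r * ‖deriv f c‖ / 128 ≤ 4 * (s * A) / 128 := by gcongr
    _ = s * A ^ 2 / (16 * (2 * A)) := by field_simp; norm_num

lemma exists_hasDerivAt_exp_eq (hf : DifferentiableOn ℂ f (ball c r))
    (hne : ∀ z ∈ ball c r, f z ≠ 0) :
    ∃ L : ℂ → ℂ, ∀ z ∈ ball c r, HasDerivAt L (deriv f z / f z) z ∧ exp (L z) = f z := by
  obtain ⟨L, hLc, hL⟩ :=
    ((hf.deriv isOpen_ball).div hf hne).isExactOn_ball.with_val_at c (log (f c))
  have hquot : ∀ z ∈ ball c r, HasDerivAt (fun z => f z * exp (-L z)) 0 z := by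
    intro z hz
    refine ((hf.hasDerivAt (isOpen_ball.mem_nhds hz)).mul (hL z hz).neg.cexp).congr_deriv ?_
    change deriv f z * exp (-L z) + f z * (exp (-L z) * -(deriv f z / f z)) = 0
    field [hne z hz]
  refine ⟨L, fun z hz => ⟨hL z hz, ?_⟩⟩
  have hc : c ∈ ball c r := mem_ball_self (pos_of_mem_ball hz)
  have hconst : f z * exp (-L z) = f c * exp (-L c) :=
    isOpen_ball.is_const_of_deriv_eq_zero (convex_ball c r).isPreconnected
      (fun x hx => (hquot x hx).differentiableAt.differentiableWithinAt)
      (fun x hx => (hquot x hx).deriv) hz hc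
  rw [hLc, exp_neg, exp_neg, exp_log (hne c hc), mul_inv_cancel₀ (hne c hc)] at hconst
  rw [← one_mul (exp (L z)), ← hconst, mul_assoc, inv_mul_cancel₀ (exp_ne_zero _), mul_one]

/-- A weak form of the Koebe one-quarter theorem. A branch of `log (f - w₀)` takes no two values
differing by `2πi`, so Bloch's theorem bounds its derivative. -/
lemma mul_norm_deriv_le_of_notMem_image (hf : DifferentiableOn ℂ f (ball c r))
    (hinj : InjOn f (ball c r)) (hr : 0 < r) (hw : w₀ ∉ f '' ball c r) :
    r * ‖deriv f c‖ ≤ 512 * ‖f c - w₀‖ := by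
  have hc : c ∈ ball c r := mem_ball_self hr
  have hne : ∀ z ∈ ball c r, f z - w₀ ≠ 0 := fun z hz h => hw ⟨z, hz, sub_eq_zero.1 h⟩
  by_cases h0 : deriv f c = 0
  · rw [h0, norm_zero, mul_zero]
    positivity
  obtain ⟨L, hL⟩ := exists_hasDerivAt_exp_eq (hf.sub_const w₀) hne
  have hLc : ‖deriv L c‖ = ‖deriv f c‖ / ‖f c - w₀‖ := by
    rw [(hL c hc).1.deriv, deriv_sub_const, norm_div]
  obtain ⟨w, hball⟩ := exists_ball_subset_image
    (fun z hz => (hL z hz).1.differentiableAt.differentiableWithinAt) hr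
    (norm_pos_iff.1 (hLc ▸ div_pos (norm_pos_iff.2 h0) (norm_pos_iff.2 (hne c hc))))
  have hle : r * ‖deriv L c‖ / 128 ≤ Real.pi := by
    by_contra! hlt
    have hπ : ‖(Real.pi : ℂ) * I‖ = Real.pi := by simp [abs_of_pos Real.pi_pos]
    obtain ⟨z₁, hz₁, e₁⟩ := hball (show w + Real.pi * I ∈ _ by
      rwa [mem_ball_iff_norm, add_sub_cancel_left, hπ])
    obtain ⟨z₂, hz₂, e₂⟩ := hball (show w - Real.pi * I ∈ _ by
      rwa [mem_ball_iff_norm, sub_sub_cancel_left, norm_neg, hπ])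
    have hdiff : L z₁ = L z₂ + 2 * Real.pi * I := by rw [e₁, e₂]; ring
    have heq : f z₁ = f z₂ := by
      rw [← sub_left_inj (a := w₀), ← (hL z₁ hz₁).2, ← (hL z₂ hz₂).2, hdiff, exp_periodic]
    rw [hinj hz₁ hz₂ heq] at hdiff
    exact two_pi_I_ne_zero (left_eq_add.1 hdiff)
  have hpos := norm_pos_iff.2 (hne c hc)
  have h512 : r * ‖deriv L c‖ ≤ 512 := by linarith [Real.pi_le_four]
  rwa [hLc, ← mul_div_assoc, div_le_iff₀ hpos] at h512

/-- Cauchy's estimate for the logarithmic derivative of `f - w₀`. -/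
lemma sq_mul_norm_deriv_deriv_le_of_notMem_image (hf : DifferentiableOn ℂ f (ball c r))
    (hinj : InjOn f (ball c r)) (hr : 0 < r) (hw : w₀ ∉ f '' ball c r) :
    r ^ 2 * ‖deriv (deriv f) c‖ ≤ 2048 * ‖f c - w₀‖ + 1024 * (r * ‖deriv f c‖) := by
  have hne : ∀ z ∈ ball c r, f z - w₀ ≠ 0 := fun z hz h => hw ⟨z, hz, sub_eq_zero.1 h⟩
  have hc : ball c r ∈ 𝓝 c := ball_mem_nhds c hr
  set q : ℂ → ℂ := fun z => deriv f z / (f z - w₀) with hq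
  have hqd : DifferentiableOn ℂ q (ball c r) := (hf.deriv isOpen_ball).div (hf.sub_const w₀) hne
  have hqb : ∀ z ∈ closedBall c (r / 2), ‖q z‖ ≤ 1024 / r := by
    intro z hz
    have hsub : ball z (r / 2) ⊆ ball c r := ball_subset_ball' (by
      linarith [mem_closedBall.1 hz])
    have hkoebe := mul_norm_deriv_le_of_notMem_image (hf.mono hsub) (hinj.mono hsub)
      (half_pos hr) (fun h => hw (image_mono hsub h))
    rw [hq, norm_div,
      div_le_div_iff₀ (norm_pos_iff.2 (hne z (hsub (mem_ball_self (half_pos hr))))) hr]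
    linarith
  have hq' : ‖deriv q c‖ ≤ 1024 / r / (r / 2) :=
    norm_deriv_le_of_forall_mem_sphere_norm_le (half_pos hr)
      ((hqd.mono (closedBall_subset_ball (half_lt_self hr))).diffContOnCl_ball subset_rfl)
      fun z hz => hqb z (sphere_subset_closedBall hz)
  have hderiv : deriv (deriv f) c = deriv q c * (f c - w₀) + q c * deriv f c := by
    rw [← ((hqd.hasDerivAt hc).mul ((hf.hasDerivAt hc).sub_const w₀)).deriv]
    refine Filter.EventuallyEq.deriv_eq ?_
    filter_upwards [hc] with z hz
    exact (div_mul_cancel₀ _ (hne z hz)).symm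
  calc r ^ 2 * ‖deriv (deriv f) c‖
      ≤ r ^ 2 * (‖deriv q c‖ * ‖f c - w₀‖ + ‖q c‖ * ‖deriv f c‖) := by
        rw [hderiv, ← norm_mul, ← norm_mul]
        gcongr
        exact norm_add_le _ _
    _ ≤ r ^ 2 * (1024 / r / (r / 2) * ‖f c - w₀‖ + 1024 / r * ‖deriv f c‖) := by
        gcongr
        exact hqb c (mem_closedBall_self (half_pos hr).le)
    _ = 2048 * ‖f c - w₀‖ + 1024 * (r * ‖deriv f c‖) := by field_simp; ring

end Univalent

/-! ### Holomorphic maps of the half-plane -/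

section HalfPlane

open Metric Complex

lemma isOpen_rightHalfPlane : IsOpen rightHalfPlane :=
  isOpen_lt continuous_const continuous_re

lemma ofReal_mem_rightHalfPlane {x : ℝ} : (x : ℂ) ∈ rightHalfPlane ↔ 0 < x := Iff.rfl

lemma ball_subset_rightHalfPlane {z : ℂ} {r : ℝ} (hr : r ≤ z.re) : ball z r ⊆ rightHalfPlane := by
  intro w hw
  have hre := neg_le_of_abs_le (abs_re_le_norm (w - z))
  rw [mem_ball_iff_norm] at hw
  rw [sub_re] at hre
  change 0 < w.re
  linarith

/-- The Schwarz lemma after the Cayley transform `w ↦ (w - T c) / (w + conj (T c))`. -/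
lemma mul_norm_deriv_le_two_mul_re {T : ℂ → ℂ} {c : ℂ} {r : ℝ} (hr : 0 < r)
    (hT : DifferentiableOn ℂ T (ball c r)) (hmaps : MapsTo T (ball c r) rightHalfPlane) :
    r * ‖deriv T c‖ ≤ 2 * (T c).re := by
  set b := (starRingEnd ℂ) (T c)
  have hre : ∀ z ∈ ball c r, 0 < (T z).re := hmaps
  have hc : c ∈ ball c r := mem_ball_self hr
  have hden : ∀ z ∈ ball c r, T z + b ≠ 0 := by
    intro z hz h0
    have := congrArg re h0
    rw [add_re, conj_re, zero_re] at this
    linarith [hre z hz, hre c hc]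
  have hcayley : MapsTo (fun z => (T z - T c) / (T z + b)) (ball c r)
      (closedBall ((T c - T c) / (T c + b)) 1) := by
    intro z hz
    rw [sub_self, zero_div, mem_closedBall_zero_iff, norm_div,
      div_le_one (norm_pos_iff.2 (hden z hz)), ← sq_le_sq₀ (norm_nonneg _) (norm_nonneg _),
      Complex.sq_norm, Complex.sq_norm, normSq_apply, normSq_apply, sub_re, sub_im, add_re, add_im,
      conj_re, conj_im]
    nlinarith [mul_pos (hre z hz) (hre c hc)]
  have hb : T c + b = (2 * (T c).re : ℝ) := add_conj (T c)
  have hT' := hT.hasDerivAt (isOpen_ball.mem_nhds hc)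
  have hschwarz := norm_deriv_le_div_of_mapsTo_ball
    ((hT.sub_const _).div (hT.add_const b) hden) hcayley hr
  rw [((hT'.sub_const (T c)).div (hT'.add_const b) (hden c hc)).deriv, sub_self, zero_mul,
    sub_zero, hb, norm_div, norm_mul, norm_pow, norm_real, Real.norm_eq_abs,
    abs_of_pos (by linarith [hre c hc]), div_le_div_iff₀ (by nlinarith [hre c hc]) hr] at hschwarz
  refine le_of_mul_le_mul_right ?_ (mul_pos two_pos (hre c hc))
  calc r * ‖deriv T c‖ * (2 * (T c).re) = ‖deriv T c‖ * (2 * (T c).re) * r := by ring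
    _ ≤ 1 * (2 * (T c).re) ^ 2 := hschwarz
    _ = 2 * (T c).re * (2 * (T c).re) := by ring

end HalfPlane

section Harnack

variable {F : ℂ → ℂ} {K : ℝ} {z w : ℂ}

/-- Grönwall's inequality along `γ`, whose speed in the hyperbolic metric is at most `N`. -/
lemma norm_le_mul_exp_of_path (hF : DifferentiableOn ℂ F rightHalfPlane)
    (hF' : ∀ z ∈ rightHalfPlane, ‖deriv F z‖ ≤ K / z.re * ‖F z‖) {γ γ' : ℝ → ℂ} {N : ℝ}
    (hK : 0 ≤ K) (hγ : ∀ s, HasDerivAt γ (γ' s) s) (hmem : ∀ s, γ s ∈ rightHalfPlane)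
    (hN : ∀ s, ‖γ' s‖ ≤ N * (γ s).re) :
    ‖F (γ 1)‖ ≤ ‖F (γ 0)‖ * Real.exp (K * N) := by
  have hderiv : ∀ s, HasDerivAt (fun s => F (γ s)) (deriv F (γ s) * γ' s) s := fun s =>
    (hF.hasDerivAt (isOpen_rightHalfPlane.mem_nhds (hmem s))).comp s (hγ s)
  have hbound : ∀ s, ‖deriv F (γ s) * γ' s‖ ≤ K * N * ‖F (γ s)‖ := by
    intro s
    have hre : 0 < (γ s).re := hmem s
    calc ‖deriv F (γ s) * γ' s‖ ≤ K / (γ s).re * ‖F (γ s)‖ * (N * (γ s).re) := by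
          rw [norm_mul]
          gcongr
          exacts [hF' _ (hmem s), hN s]
      _ = K * N * ‖F (γ s)‖ := by field_simp
  have := norm_le_gronwallBound_of_norm_deriv_right_le (ε := 0)
    (fun s _ => (hderiv s).continuousAt.continuousWithinAt)
    (fun s _ => (hderiv s).hasDerivWithinAt) le_rfl
    (fun s _ => (hbound s).trans_eq (add_zero _).symm) 1 (right_mem_Icc.2 zero_le_one)
  simpa only [gronwallBound_ε0, sub_zero, mul_one] using this

lemma norm_le_mul_exp_of_re_eq (hF : DifferentiableOn ℂ F rightHalfPlane)
    (hF' : ∀ z ∈ rightHalfPlane, ‖deriv F z‖ ≤ K / z.re * ‖F z‖) (hK : 0 ≤ K)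
    (hz : z ∈ rightHalfPlane) (hzw : w.re = z.re) :
    ‖F w‖ ≤ ‖F z‖ * Real.exp (K * (|w.im - z.im| / z.re)) := by
  have hre : ∀ s : ℝ, (z + (s : ℂ) * (w - z)).re = z.re := by simp [hzw]
  have hnorm : ‖w - z‖ = |w.im - z.im| := by
    rw [← Complex.sub_im, Complex.abs_im_eq_norm.2 (by rw [Complex.sub_re, hzw, sub_self])]
  have hpath := norm_le_mul_exp_of_path hF hF' (γ := fun s : ℝ => z + (s : ℂ) * (w - z))
    (γ' := fun _ => w - z) (N := |w.im - z.im| / z.re) hK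
    (fun s => by
      simpa only [Complex.ofRealCLM_apply, Complex.ofReal_one, one_mul] using
        ((Complex.ofRealCLM.hasDerivAt (x := s)).mul_const (w - z)).const_add z)
    (fun s => (hz : 0 < z.re).trans_eq (hre s).symm)
    (fun s => by rw [hre, div_mul_cancel₀ _ (ne_of_gt hz), hnorm])
  simpa using hpath

lemma norm_le_mul_exp_of_im_eq (hF : DifferentiableOn ℂ F rightHalfPlane)
    (hF' : ∀ z ∈ rightHalfPlane, ‖deriv F z‖ ≤ K / z.re * ‖F z‖) (hK : 0 ≤ K)
    (hz : z ∈ rightHalfPlane) (hw : w ∈ rightHalfPlane) (hzw : w.im = z.im) :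
    ‖F w‖ ≤ ‖F z‖ * Real.exp (K * |Real.log (w.re / z.re)|) := by
  have hz0 : 0 < z.re := hz
  have hw0 : 0 < w.re := hw
  set a := Real.log (w.re / z.re) with ha
  have hre : ∀ s : ℝ,
      (((z.re * Real.exp (s * a) : ℝ) : ℂ) + z.im * Complex.I).re = z.re * Real.exp (s * a) := by
    intro s
    rw [Complex.add_re, Complex.ofReal_re, Complex.re_ofReal_mul, Complex.I_re, mul_zero, add_zero]
  have hpath := norm_le_mul_exp_of_path hF hF' (N := |a|)
    (γ := fun s => ((z.re * Real.exp (s * a) : ℝ) : ℂ) + z.im * Complex.I)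
    (γ' := fun s => ((z.re * (Real.exp (s * a) * a) : ℝ) : ℂ)) hK
    (fun s => (((hasDerivAt_mul_const a).exp.const_mul z.re).ofReal_comp).add_const _)
    (fun s => by
      change 0 < Complex.re _
      rw [hre]
      positivity)
    (fun s => by
      rw [hre, Complex.norm_real, Real.norm_eq_abs, ← mul_assoc,
        abs_mul, abs_of_pos (by positivity : 0 < z.re * Real.exp (s * a)), mul_comm])
  have hexp : z.re * Real.exp a = w.re := by
    rw [ha, Real.exp_log (div_pos hw0 hz0), mul_div_cancel₀ _ hz0.ne']
  simpa only [one_mul, zero_mul, Real.exp_zero, mul_one, hexp, ← hzw, Complex.re_add_im, hzw ▸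
    Complex.re_add_im z] using hpath

lemma norm_le_mul_exp (hF : DifferentiableOn ℂ F rightHalfPlane)
    (hF' : ∀ z ∈ rightHalfPlane, ‖deriv F z‖ ≤ K / z.re * ‖F z‖) (hK : 0 ≤ K)
    (hz : z ∈ rightHalfPlane) (hw : w ∈ rightHalfPlane) :
    ‖F w‖ ≤ ‖F z‖ * Real.exp (K * (|Real.log (w.re / z.re)| + |w.im - z.im| / w.re)) := by
  have hcorner : (⟨w.re, z.im⟩ : ℂ) ∈ rightHalfPlane := hw
  calc ‖F w‖ ≤ ‖F ⟨w.re, z.im⟩‖ * Real.exp (K * (|w.im - z.im| / w.re)) :=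
        norm_le_mul_exp_of_re_eq hF hF' hK hcorner rfl
    _ ≤ ‖F z‖ * Real.exp (K * |Real.log (w.re / z.re)|) *
        Real.exp (K * (|w.im - z.im| / w.re)) := by
        gcongr
        exact norm_le_mul_exp_of_im_eq hF hF' hK hz hcorner rfl
    _ = _ := by rw [mul_assoc, ← Real.exp_add, ← mul_add]

end Harnack

/-- The constant `C` in the estimate `|φ''| ≤ C |φ'| / Re z` for a tract model; it is not sharp. -/
noncomputable def distortionConst : ℝ := 7168

lemma distortionConst_pos : 0 < distortionConst := by norm_num [distortionConst]

namespace IsTractModel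

open Metric

variable {Ω : Set ℂ} {τ φ : ℂ → ℂ} {z w : ℂ}

lemma injOn (h : IsTractModel Ω τ φ) : InjOn φ rightHalfPlane :=
  LeftInvOn.injOn h.right_inv

lemma hasDerivAt (h : IsTractModel Ω τ φ) (hz : z ∈ rightHalfPlane) :
    HasDerivAt φ (deriv φ z) z :=
  h.holo_inv.hasDerivAt (isOpen_rightHalfPlane.mem_nhds hz)

lemma hasDerivAt_tau (h : IsTractModel Ω τ φ) (hz : z ∈ Ω) : HasDerivAt τ (deriv τ z) z :=
  h.holo.hasDerivAt (h.isOpen.mem_nhds hz)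

lemma differentiableOn_deriv (h : IsTractModel Ω τ φ) :
    DifferentiableOn ℂ (deriv φ) rightHalfPlane :=
  h.holo_inv.deriv isOpen_rightHalfPlane

lemma deriv_tau_mul_deriv (h : IsTractModel Ω τ φ) (hz : z ∈ rightHalfPlane) :
    deriv τ (φ z) * deriv φ z = 1 := by
  refine ((h.hasDerivAt_tau (h.mapsTo_inv hz)).comp z (h.hasDerivAt hz)).unique ?_
  refine (hasDerivAt_id z).congr_of_eventuallyEq ?_
  filter_upwards [isOpen_rightHalfPlane.mem_nhds hz] with w hw using h.right_inv w hw

lemma norm_deriv_pos (h : IsTractModel Ω τ φ) (hz : z ∈ rightHalfPlane) : 0 < ‖deriv φ z‖ :=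
  norm_pos_iff.2 (right_ne_zero_of_mul_eq_one (h.deriv_tau_mul_deriv hz))

lemma le_of_ball_subset (h : IsTractModel Ω τ φ) (hz : z ∈ rightHalfPlane) {ρ : ℝ}
    (hρ : 0 < ρ) (hsub : ball (φ z) ρ ⊆ Ω) : ρ ≤ 2 * z.re * ‖deriv φ z‖ := by
  have hschwarz := mul_norm_deriv_le_two_mul_re hρ (h.holo.mono hsub) (h.mapsTo.mono_left hsub)
  rw [h.right_inv z hz] at hschwarz
  calc ρ = ρ * ‖deriv τ (φ z) * deriv φ z‖ := by
        rw [h.deriv_tau_mul_deriv hz, norm_one, mul_one]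
    _ = ρ * ‖deriv τ (φ z)‖ * ‖deriv φ z‖ := by rw [norm_mul, mul_assoc]
    _ ≤ 2 * z.re * ‖deriv φ z‖ := by gcongr

lemma exists_notMem_norm_sub_le (h : IsTractModel Ω τ φ) (hz : z ∈ rightHalfPlane) :
    ∃ w, w ∉ Ω ∧ ‖φ z - w‖ ≤ 3 * (z.re * ‖deriv φ z‖) := by
  have hpos : 0 < z.re * ‖deriv φ z‖ := mul_pos hz (h.norm_deriv_pos hz)
  by_contra! hcon
  have hsub : ball (φ z) (3 * (z.re * ‖deriv φ z‖)) ⊆ Ω := by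
    intro w hw
    by_contra hwΩ
    exact (hcon w hwΩ).not_gt (mem_ball_iff_norm'.1 hw)
  linarith [h.le_of_ball_subset hz (by positivity) hsub]

lemma norm_deriv_deriv_le (h : IsTractModel Ω τ φ) (hz : z ∈ rightHalfPlane) :
    ‖deriv (deriv φ) z‖ ≤ distortionConst / z.re * ‖deriv φ z‖ := by
  have hz0 : 0 < z.re := hz
  obtain ⟨w, hwΩ, hw⟩ := h.exists_notMem_norm_sub_le hz
  have hsub := ball_subset_rightHalfPlane (le_refl z.re)
  have hkoebe := sq_mul_norm_deriv_deriv_le_of_notMem_image (h.holo_inv.mono hsub)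
    (h.injOn.mono hsub) hz0 (w₀ := w)
    (by rintro ⟨x, hx, rfl⟩; exact hwΩ (h.mapsTo_inv (hsub hx)))
  rw [div_mul_eq_mul_div, le_div_iff₀ hz0]
  refine le_of_mul_le_mul_right ?_ hz0
  calc ‖deriv (deriv φ) z‖ * z.re * z.re = z.re ^ 2 * ‖deriv (deriv φ) z‖ := by ring
    _ ≤ 2048 * (3 * (z.re * ‖deriv φ z‖)) + 1024 * (z.re * ‖deriv φ z‖) := by linarith
    _ = distortionConst * ‖deriv φ z‖ * z.re := by rw [distortionConst]; ring

lemma norm_deriv_le_mul_exp (h : IsTractModel Ω τ φ) (hz : z ∈ rightHalfPlane)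
    (hw : w ∈ rightHalfPlane) : ‖deriv φ w‖ ≤ ‖deriv φ z‖ *
      Real.exp (distortionConst * (|Real.log (w.re / z.re)| + |w.im - z.im| / w.re)) :=
  norm_le_mul_exp h.differentiableOn_deriv (fun _ hx => h.norm_deriv_deriv_le hx)
    distortionConst_pos.le hz hw

lemma norm_deriv_mul_norm_sub_le (h : IsTractModel Ω τ φ) (hw : w ∈ rightHalfPlane)
    (hzw : ‖z - w‖ ≤ z.re) : ‖deriv φ z‖ * ‖z - w‖ ≤ 512 * ‖φ z - φ w‖ := by
  rcases (norm_nonneg (z - w)).eq_or_lt with h0 | h0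
  · rw [← h0, mul_zero]
    positivity
  have hsub := ball_subset_rightHalfPlane hzw
  rw [mul_comm]
  refine mul_norm_deriv_le_of_notMem_image (h.holo_inv.mono hsub) (h.injOn.mono hsub) h0 ?_
  rintro ⟨x, hx, hxw⟩
  rw [h.injOn (hsub hx) hw hxw, mem_ball_iff_norm'] at hx
  exact hx.false

end IsTractModel

/-! ### Systems of inverse branches -/

section BranchSystem

open Metric

/-- A finite system of inverse branches `ψ i`, `i ∈ S`, of `f` on the disk `B(c, r)`, contracting
and with pairwise disjoint images in a smaller disk: a conformal iterated function system whose
limit set is an expanding repeller of `f`. -/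
structure IsBranchSystem {ι : Type*} (f : ℂ → ℂ) (Ω : Set ℂ) (S : Finset ι) (ψ : ι → ℂ → ℂ)
    (c : ℂ) (r r' : ℝ) : Prop where
  pos : 0 < r
  lt : r' < r
  isOpen : IsOpen Ω
  holo : DifferentiableOn ℂ f Ω
  nonempty : S.Nonempty
  mapsTo : ∀ i ∈ S, MapsTo (ψ i) (ball c r) (closedBall c r')
  mapsTo_dom : ∀ i ∈ S, MapsTo (ψ i) (ball c r) Ω
  holo_branch : ∀ i ∈ S, DifferentiableOn ℂ (ψ i) (ball c r)
  inv : ∀ i ∈ S, ∀ w ∈ ball c r, f (ψ i w) = w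
  ne : ∀ i ∈ S, ∀ j ∈ S, i ≠ j → ∀ w ∈ ball c r, ψ i w ≠ ψ j w
  contr : ∀ i ∈ S, ∀ w ∈ ball c r, ‖deriv (ψ i) w‖ ≤ 1 / 2

/-- The limit set of a system of inverse branches: the points whose whole orbit stays in the union
of the images of the branches. -/
def branchLimitSet {ι : Type*} (f : ℂ → ℂ) (S : Finset ι) (ψ : ι → ℂ → ℂ) (c : ℂ) (r : ℝ) :
    Set ℂ :=
  {z | ∀ n : ℕ, ∃ i ∈ S, f^[n] z ∈ ψ i '' ball c r}

variable {ι : Type*} {f : ℂ → ℂ} {Ω : Set ℂ} {S : Finset ι} {ψ : ι → ℂ → ℂ} {c : ℂ} {r r' : ℝ}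
  {z : ℂ} {i : ι}

lemma mapsTo_branchLimitSet :
    MapsTo f (branchLimitSet f S ψ c r) (branchLimitSet f S ψ c r) := by
  intro z hz n
  simpa only [Function.iterate_succ_apply] using hz (n + 1)

namespace IsBranchSystem

lemma closedBall_subset (h : IsBranchSystem f Ω S ψ c r r') : closedBall c r' ⊆ ball c r :=
  closedBall_subset_ball h.lt

lemma mem_closedBall (h : IsBranchSystem f Ω S ψ c r r') (hz : z ∈ branchLimitSet f S ψ c r) :
    z ∈ closedBall c r' := by
  obtain ⟨i, hi, w, hw, rfl : ψ i w = z⟩ := hz 0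
  exact h.mapsTo i hi hw

lemma mem_ball (h : IsBranchSystem f Ω S ψ c r r') (hz : z ∈ branchLimitSet f S ψ c r) :
    z ∈ ball c r :=
  h.closedBall_subset (h.mem_closedBall hz)

lemma exists_branch_apply_eq (h : IsBranchSystem f Ω S ψ c r r')
    (hz : z ∈ branchLimitSet f S ψ c r) : ∃ i ∈ S, ψ i (f z) = z := by
  obtain ⟨i, hi, w, hw, rfl : ψ i w = z⟩ := hz 0
  exact ⟨i, hi, by rw [h.inv i hi w hw]⟩

lemma branch_mem (h : IsBranchSystem f Ω S ψ c r r') (hz : z ∈ branchLimitSet f S ψ c r)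
    (hi : i ∈ S) : ψ i z ∈ branchLimitSet f S ψ c r
  | 0 => ⟨i, hi, z, h.mem_ball hz, rfl⟩
  | n + 1 => by
    rw [Function.iterate_succ_apply, h.inv i hi z (h.mem_ball hz)]
    exact hz n

lemma mem_dom (h : IsBranchSystem f Ω S ψ c r r') (hz : z ∈ branchLimitSet f S ψ c r) :
    z ∈ Ω := by
  obtain ⟨i, hi, hzi⟩ := h.exists_branch_apply_eq hz
  exact hzi ▸ h.mapsTo_dom i hi (h.mem_ball (mapsTo_branchLimitSet hz))

lemma hasDerivAt_branch (h : IsBranchSystem f Ω S ψ c r r') (hi : i ∈ S) (hz : z ∈ ball c r) :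
    HasDerivAt (ψ i) (deriv (ψ i) z) z :=
  (h.holo_branch i hi).hasDerivAt (isOpen_ball.mem_nhds hz)

lemma hasDerivAt (h : IsBranchSystem f Ω S ψ c r r') (hz : z ∈ Ω) :
    HasDerivAt f (deriv f z) z :=
  h.holo.hasDerivAt (h.isOpen.mem_nhds hz)

lemma deriv_mul_deriv (h : IsBranchSystem f Ω S ψ c r r') (hi : i ∈ S) (hz : z ∈ ball c r) :
    deriv f (ψ i z) * deriv (ψ i) z = 1 := by
  refine ((h.hasDerivAt (h.mapsTo_dom i hi hz)).comp z (h.hasDerivAt_branch hi hz)).unique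
    ((hasDerivAt_id z).congr_of_eventuallyEq ?_)
  filter_upwards [isOpen_ball.mem_nhds hz] with w hw using h.inv i hi w hw

lemma norm_branch_sub_le (h : IsBranchSystem f Ω S ψ c r r') (hi : i ∈ S) {x y : ℂ}
    (hx : x ∈ ball c r) (hy : y ∈ ball c r) : ‖ψ i x - ψ i y‖ ≤ 1 / 2 * ‖x - y‖ :=
  (convex_ball c r).norm_image_sub_le_of_norm_hasDerivWithin_le
    (fun _ hw => (h.hasDerivAt_branch hi hw).hasDerivWithinAt) (h.contr i hi) hy hx

lemma eq_of_branch_eq (h : IsBranchSystem f Ω S ψ c r r') {j : ι} (hi : i ∈ S) (hj : j ∈ S)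
    {x y : ℂ} (hx : x ∈ ball c r) (hy : y ∈ ball c r) (hxy : ψ i x = ψ j y) : i = j := by
  have hfxy : x = y := by rw [← h.inv i hi x hx, hxy, h.inv j hj y hy]
  by_contra hij
  exact h.ne i hi j hj hij x hx (hfxy ▸ hxy)

lemma nonempty_branchLimitSet (h : IsBranchSystem f Ω S ψ c r r') :
    (branchLimitSet f S ψ c r).Nonempty := by
  obtain ⟨i, hi⟩ := h.nonempty
  have hmaps : MapsTo (ψ i) (closedBall c r') (closedBall c r') :=
    (h.mapsTo i hi).mono_left h.closedBall_subset
  have hcontr : ContractingWith (1 / 2) (hmaps.restrict (ψ i) _ _) := by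
    refine ⟨by norm_num, LipschitzWith.of_dist_le_mul fun x y => ?_⟩
    simpa [Subtype.dist_eq, dist_eq_norm] using
      h.norm_branch_sub_le hi (h.closedBall_subset x.2) (h.closedBall_subset y.2)
  obtain ⟨y, hy, hfix, -⟩ := hcontr.exists_fixedPoint' isClosed_closedBall.isComplete hmaps
    (h.mapsTo i hi (mem_ball_self h.pos)) (edist_ne_top _ _)
  have hyball := h.closedBall_subset hy
  have hfy : f y = y := by
    simpa only [hfix.eq] using h.inv i hi y hyball
  exact ⟨y, fun n => ⟨i, hi, y, hyball, hfix.trans (Function.iterate_fixed hfy n).symm⟩⟩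

lemma isCompact_image (h : IsBranchSystem f Ω S ψ c r r') (hi : i ∈ S) :
    IsCompact (ψ i '' closedBall c r') :=
  (isCompact_closedBall c r').image_of_continuousOn
    ((h.holo_branch i hi).continuousOn.mono h.closedBall_subset)

lemma isCompact_branchLimitSet (h : IsBranchSystem f Ω S ψ c r r') :
    IsCompact (branchLimitSet f S ψ c r) := by
  set X := branchLimitSet f S ψ c r
  have hK : IsCompact (⋃ i ∈ S, ψ i '' closedBall c r') :=
    S.isCompact_biUnion fun i hi => h.isCompact_image hi
  have hXK : X ⊆ ⋃ i ∈ S, ψ i '' closedBall c r' := by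
    intro z hz
    obtain ⟨i, hi, hzi⟩ := h.exists_branch_apply_eq hz
    exact mem_biUnion hi ⟨f z, h.mem_closedBall (mapsTo_branchLimitSet hz), hzi⟩
  have hclosure : closure X ⊆ ⋃ i ∈ S, ψ i '' closedBall c r' := closure_minimal hXK hK.isClosed
  have hdom : closure X ⊆ Ω := hclosure.trans <| iUnion₂_subset fun i hi =>
    ((h.mapsTo_dom i hi).mono_left h.closedBall_subset).image_subset
  have hmaps : MapsTo f (closure X) (closure X) :=
    mapsTo_branchLimitSet.closure_of_continuousOn (h.holo.continuousOn.mono hdom)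
  refine hK.of_isClosed_subset (isClosed_of_closure_subset fun z hz n => ?_) hXK
  obtain ⟨i, hi, hzi⟩ := mem_iUnion₂.1 (hclosure (hmaps.iterate n hz))
  exact ⟨i, hi, image_mono h.closedBall_subset hzi⟩

lemma exists_hasDerivAt_iterate (h : IsBranchSystem f Ω S ψ c r r') (n : ℕ)
    (hz : z ∈ branchLimitSet f S ψ c r) : ∃ d, HasDerivAt f^[n] d z ∧ 2 ^ n ≤ ‖d‖ := by
  induction n generalizing z with
  | zero => exact ⟨1, hasDerivAt_id z, by simp⟩
  | succ n ih =>
    have hfz := mapsTo_branchLimitSet hz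
    obtain ⟨d, hd, hdn⟩ := ih hfz
    obtain ⟨i, hi, hzi⟩ := h.exists_branch_apply_eq hz
    have hmul := congrArg norm (h.deriv_mul_deriv hi (h.mem_ball hfz))
    rw [hzi, norm_mul, norm_one] at hmul
    have hderiv : 2 ≤ ‖deriv f z‖ := by
      nlinarith [norm_nonneg (deriv f z), h.contr i hi _ (h.mem_ball hfz)]
    refine ⟨_, hd.comp z (h.hasDerivAt (h.mem_dom hz)), ?_⟩
    rw [norm_mul, pow_succ]
    gcongr

lemma isOpen_image (h : IsBranchSystem f Ω S ψ c r r') (hi : i ∈ S) :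
    IsOpen (ψ i '' ball c r) := by
  refine isOpen_iff_mem_nhds.2 ?_
  rintro _ ⟨w, hw, rfl⟩
  have han := (h.holo_branch i hi).analyticAt (isOpen_ball.mem_nhds hw)
  rw [← han.hasStrictDerivAt.map_nhds_eq (right_ne_zero_of_mul_eq_one (h.deriv_mul_deriv hi hw))]
  exact image_mem_map (isOpen_ball.mem_nhds hw)

lemma isExpandingRepeller (h : IsBranchSystem f Ω S ψ c r r') :
    IsExpandingRepeller f Ω (branchLimitSet f S ψ c r) where
  isCompact := h.isCompact_branchLimitSet
  nonempty := h.nonempty_branchLimitSet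
  image_eq := by
    refine mapsTo_branchLimitSet.image_subset.antisymm fun z hz => ?_
    obtain ⟨i, hi⟩ := h.nonempty
    exact ⟨ψ i z, h.branch_mem hz hi, h.inv i hi z (h.mem_ball hz)⟩
  expanding := by
    refine ⟨1, 2, one_pos, one_lt_two, fun n z hz => ?_⟩
    obtain ⟨d, hd, hn⟩ := h.exists_hasDerivAt_iterate n hz
    rwa [hd.deriv, one_mul]
  isolated := by
    refine ⟨⋃ i ∈ S, ψ i '' ball c r, isOpen_biUnion fun i hi => h.isOpen_image hi, fun z hz => ?_,
      iUnion₂_subset fun i hi => (h.mapsTo_dom i hi).image_subset, fun z hz n => ?_⟩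
    · obtain ⟨i, hi, hzi⟩ := hz 0
      exact mem_biUnion hi hzi
    · simpa using hz n

lemma exists_separation (h : IsBranchSystem f Ω S ψ c r r') :
    ∃ d > 0, ∀ i ∈ S, ∀ j ∈ S, i ≠ j → ∀ x ∈ closedBall c r', ∀ y ∈ closedBall c r',
      d ≤ ‖ψ i x - ψ j y‖ := by
  suffices hev : ∀ i ∈ S, ∀ j ∈ S, ∀ᶠ d in 𝓝[>] (0 : ℝ), i ≠ j →
      ∀ x ∈ closedBall c r', ∀ y ∈ closedBall c r', d ≤ ‖ψ i x - ψ j y‖ by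
    have hall := (S.eventually_all).2 fun i hi => (S.eventually_all).2 fun j hj => hev i hi j hj
    obtain ⟨d, hd, hd0⟩ := (hall.and self_mem_nhdsWithin).exists
    exact ⟨d, hd0, hd⟩
  intro i hi j hj
  rcases eq_or_ne i j with rfl | hij
  · exact Eventually.of_forall fun _ hne => (hne rfl).elim
  have hdisj : Disjoint (ψ i '' closedBall c r') (ψ j '' closedBall c r') := by
    rw [Set.disjoint_left]
    rintro _ ⟨x, hx, rfl⟩ ⟨y, hy, hxy⟩
    exact hij (h.eq_of_branch_eq hi hj (h.closedBall_subset hx) (h.closedBall_subset hy) hxy.symm)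
  obtain ⟨δ, hδ, hthick⟩ :=
    hdisj.exists_thickenings (h.isCompact_image hi) (h.isCompact_image hj).isClosed
  filter_upwards [Ioo_mem_nhdsGT hδ] with d hd _ x hx y hy
  by_contra! hlt
  refine hthick.ne_of_mem (mem_thickening_iff.2 ⟨_, mem_image_of_mem _ hx, ?_⟩)
    (self_subset_thickening hδ _ (mem_image_of_mem _ hy)) rfl
  rw [dist_comm, dist_eq_norm]
  exact hlt.trans hd.2

lemma ratio_le_half (h : IsBranchSystem f Ω S ψ c r r') (hi : i ∈ S) {a : ℝ}
    (ha : ∀ x ∈ ball c r, ∀ y ∈ ball c r, a * ‖x - y‖ ≤ ‖ψ i x - ψ i y‖) : a ≤ 1 / 2 := by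
  have hr := h.pos
  have hnorm : ‖c + (r / 2 : ℝ) - c‖ = r / 2 := by
    rw [add_sub_cancel_left, Complex.norm_real, Real.norm_of_nonneg (by positivity)]
  have hmem : c + (r / 2 : ℝ) ∈ ball c r := by
    rw [mem_ball_iff_norm, hnorm]
    exact half_lt_self hr
  have hle := (ha _ hmem c (mem_ball_self hr)).trans
    (h.norm_branch_sub_le hi hmem (mem_ball_self hr))
  rw [hnorm] at hle
  exact le_of_mul_le_mul_right hle (by positivity)

lemma exists_itinerary (h : IsBranchSystem f Ω S ψ c r r') :
    ∃ k : ℂ → ι, (∀ z, k z ∈ S) ∧ ∀ i ∈ S, ∀ w ∈ ball c r, k (ψ i w) = i := by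
  have hcode : ∀ z, ∃ k ∈ S, ∀ i ∈ S, ∀ w ∈ ball c r, ψ i w = z → k = i := by
    intro z
    by_cases hz : ∃ j ∈ S, ∃ v ∈ ball c r, ψ j v = z
    · obtain ⟨j, hj, v, hv, rfl⟩ := hz
      exact ⟨j, hj, fun i hi w hw hwz => h.eq_of_branch_eq hj hi hv hw hwz.symm⟩
    · obtain ⟨j, hj⟩ := h.nonempty
      exact ⟨j, hj, fun i hi w hw hwz => (hz ⟨i, hi, w, hw, hwz⟩).elim⟩
  choose k hkS hk using hcode
  exact ⟨k, hkS, fun i hi w hw => hk _ i hi w hw rfl⟩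

end IsBranchSystem

end BranchSystem

section CodeFunction

open Metric

lemma exists_mem_partial_sum {ι : Type*} [LinearOrder ι] {S : Finset ι} {p : ι → ℝ}
    (hS : S.Nonempty) {y : ℝ} (hy : 0 ≤ y) (hy' : y ≤ ∑ j ∈ S, p j) :
    ∃ k ∈ S, ∑ j ∈ S with j < k, p j ≤ y ∧ y ≤ ∑ j ∈ S with j < k, p j + p k := by
  induction S using Finset.induction_on_max with
  | empty => exact (Finset.not_nonempty_empty hS).elim
  | insert a S hmax ih =>
    have haS : a ∉ S := fun ha => lt_irrefl _ (hmax a ha)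
    have hfilter : (insert a S).filter (· < a) = S := by
      rw [Finset.filter_insert, if_neg (lt_irrefl a), Finset.filter_true_of_mem hmax]
    by_cases hcase : S.Nonempty ∧ y ≤ ∑ j ∈ S, p j
    · obtain ⟨k, hk, hyk⟩ := ih hcase.1 hcase.2
      refine ⟨k, Finset.mem_insert_of_mem hk, ?_⟩
      rwa [Finset.filter_insert, if_neg (hmax k hk).not_gt]
    · refine ⟨a, Finset.mem_insert_self _ _, ?_, ?_⟩ <;> rw [hfilter]
      · rcases S.eq_empty_or_nonempty with rfl | hne
        · simpa using hy
        · exact (not_le.1 fun hle => hcase ⟨hne, hle⟩).le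
      · rwa [Finset.sum_insert haS, add_comm] at hy'

lemma exists_eq_add_mul_comp {α : Type*} (f : α → α) {a b : α → ℝ} (ha : ∀ z, 0 ≤ a z)
    (hb : ∀ z, 0 ≤ b z) (hab : ∀ z, a z + b z ≤ 1) :
    ∃ u : α → ℝ, (∀ z, u z ∈ Icc 0 1) ∧ ∀ z, u z = a z + b z * u (f z) := by
  -- `u` is the least fixed point of the monotone operator `u ↦ a + b • (u ∘ f)` (Knaster–Tarski).
  let T : (α → Icc (0 : ℝ) 1) →o (α → Icc (0 : ℝ) 1) :=
    { toFun := fun u z => ⟨a z + b z * (u (f z) : ℝ),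
        add_nonneg (ha z) (mul_nonneg (hb z) (u _).2.1),
        (add_le_add_right (mul_le_of_le_one_right (hb z) (u _).2.2) _).trans (hab z)⟩
      monotone' := fun u v huv z => Subtype.mk_le_mk.2 <|
        add_le_add_right (mul_le_mul_of_nonneg_left (Subtype.coe_le_coe.2 (huv (f z))) (hb z)) _ }
  exact ⟨fun z => T.lfp z, fun z => (T.lfp z).2, fun z =>
    (congrArg Subtype.val (congrFun T.map_lfp z)).symm⟩

/-- `u` is the coding map of the limit set with weights `p`: the distribution function, in the
lexicographic order of the itineraries, of the self-similar measure that gives weight `p i` to the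
image of `ψ i`. -/
structure IsCodeFunction {ι : Type*} [LinearOrder ι] (f : ℂ → ℂ) (S : Finset ι) (ψ : ι → ℂ → ℂ)
    (c : ℂ) (r : ℝ) (p : ι → ℝ) (u : ℂ → ℝ) : Prop where
  mem_Icc : ∀ z, u z ∈ Icc 0 1
  apply_branch : ∀ i ∈ S, ∀ z ∈ branchLimitSet f S ψ c r,
    u (ψ i z) = ∑ j ∈ S with j < i, p j + p i * u z

variable {ι : Type*} [LinearOrder ι] {f : ℂ → ℂ} {Ω : Set ℂ} {S : Finset ι} {ψ : ι → ℂ → ℂ}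
  {c : ℂ} {r r' : ℝ} {p s : ι → ℝ} {u : ℂ → ℝ} {t θ : ℝ}

lemma IsCodeFunction.abs_sub_le_one (hu : IsCodeFunction f S ψ c r p u) (x y : ℂ) :
    |u x - u y| ≤ 1 := by
  simpa using abs_sub_le_of_le_of_le (hu.mem_Icc x).1 (hu.mem_Icc x).2 (hu.mem_Icc y).1
    (hu.mem_Icc y).2

namespace IsBranchSystem

lemma exists_isCodeFunction (h : IsBranchSystem f Ω S ψ c r r') (hp : ∀ i ∈ S, 0 < p i)
    (hsum : ∑ i ∈ S, p i = 1) : ∃ u, IsCodeFunction f S ψ c r p u := by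
  obtain ⟨k, hkS, hk⟩ := h.exists_itinerary
  have hpartial : ∀ i ∈ S, ∑ j ∈ S with j < i, p j + p i ≤ 1 := by
    intro i hi
    have hi' : i ∉ S.filter (· < i) := by simp
    rw [← hsum, add_comm, ← Finset.sum_insert hi']
    exact Finset.sum_le_sum_of_subset_of_nonneg
      (Finset.insert_subset hi (Finset.filter_subset _ _)) fun j hj _ => (hp j hj).le
  obtain ⟨u, hu, hfix⟩ := exists_eq_add_mul_comp f
    (a := fun z => ∑ j ∈ S with j < k z, p j) (b := fun z => p (k z))
    (fun z => Finset.sum_nonneg fun j hj => (hp j (Finset.mem_filter.1 hj).1).le)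
    (fun z => (hp _ (hkS z)).le) (fun z => hpartial _ (hkS z))
  refine ⟨u, hu, fun i hi z hz => ?_⟩
  rw [hfix (ψ i z), hk i hi z (h.mem_ball hz), h.inv i hi z (h.mem_ball hz)]

end IsBranchSystem

namespace IsCodeFunction

lemma exists_abs_sub_le (h : IsBranchSystem f Ω S ψ c r r') (hu : IsCodeFunction f S ψ c r p u)
    (hp : ∀ i ∈ S, 0 < p i) (hpθ : ∀ i ∈ S, p i ≤ θ) (hsum : ∑ i ∈ S, p i = 1) (n : ℕ) {y : ℝ}
    (hy : y ∈ Icc (0 : ℝ) 1) : ∃ x ∈ branchLimitSet f S ψ c r, |u x - y| ≤ θ ^ n := by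
  induction n generalizing y with
  | zero =>
    obtain ⟨x, hx⟩ := h.nonempty_branchLimitSet
    refine ⟨x, hx, ?_⟩
    simpa using abs_sub_le_of_le_of_le (hu.mem_Icc x).1 (hu.mem_Icc x).2 hy.1 hy.2
  | succ n ih =>
    obtain ⟨k, hk, hqy, hyq⟩ := exists_mem_partial_sum h.nonempty hy.1 (hy.2.trans_eq hsum.symm)
    set q := ∑ j ∈ S with j < k, p j
    have hpk := hp k hk
    obtain ⟨x, hx, hxy⟩ := ih (y := (y - q) / p k)
      ⟨div_nonneg (by linarith) hpk.le, (div_le_one hpk).2 (by linarith)⟩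
    refine ⟨ψ k x, h.branch_mem hx hk, ?_⟩
    have hscale : q + p k * u x - y = p k * (u x - (y - q) / p k) := by field_simp; ring
    rw [hu.apply_branch k hk x hx, hscale, abs_mul, abs_of_pos hpk, pow_succ']
    exact mul_le_mul (hpθ k hk) hxy (abs_nonneg _) (hpk.le.trans (hpθ k hk))

lemma abs_sub_le_add_pow (h : IsBranchSystem f Ω S ψ c r r') (hu : IsCodeFunction f S ψ c r p u)
    (ht : 0 < t) (hs : ∀ i ∈ S, 0 < s i)
    (hlow : ∀ i ∈ S, ∀ x ∈ ball c r, ∀ y ∈ ball c r, s i * ‖x - y‖ ≤ ‖ψ i x - ψ i y‖)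
    (hp : ∀ i ∈ S, 0 < p i) (hps : ∀ i ∈ S, p i ≤ s i ^ t) (hpθ : ∀ i ∈ S, p i ≤ θ) {d : ℝ}
    (hd : 0 < d) (hsep : ∀ i ∈ S, ∀ j ∈ S, i ≠ j → ∀ x ∈ closedBall c r', ∀ y ∈ closedBall c r',
      d ≤ ‖ψ i x - ψ j y‖) (n : ℕ) {x y : ℂ} (hx : x ∈ branchLimitSet f S ψ c r)
    (hy : y ∈ branchLimitSet f S ψ c r) :
    |u x - u y| ≤ (d ^ t)⁻¹ * ‖x - y‖ ^ t + θ ^ n := by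
  obtain ⟨i₀, hi₀⟩ := h.nonempty
  have hθ : 0 ≤ θ := (hp i₀ hi₀).le.trans (hpθ i₀ hi₀)
  induction n generalizing x y with
  | zero =>
    rw [pow_zero]
    exact (hu.abs_sub_le_one x y).trans (le_add_of_nonneg_left (by positivity))
  | succ n ih =>
    obtain ⟨i, hi, hxi⟩ := h.exists_branch_apply_eq hx
    obtain ⟨j, hj, hyj⟩ := h.exists_branch_apply_eq hy
    have hfx := mapsTo_branchLimitSet hx
    have hfy := mapsTo_branchLimitSet hy
    rcases eq_or_ne i j with rfl | hij
    · have hdiff : u x - u y = p i * (u (f x) - u (f y)) := by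
        rw [← hxi, ← hyj, hu.apply_branch i hi _ hfx, hu.apply_branch i hi _ hfy, hxi, hyj]
        ring
      have hstretch : s i ^ t * ‖f x - f y‖ ^ t ≤ ‖x - y‖ ^ t := by
        have := hlow i hi _ (h.mem_ball hfx) _ (h.mem_ball hfy)
        rw [hxi, hyj] at this
        have hsi := hs i hi
        rw [← Real.mul_rpow hsi.le (norm_nonneg _)]
        exact Real.rpow_le_rpow (by positivity) this ht.le
      have hpi := (hp i hi).le
      calc |u x - u y| = p i * |u (f x) - u (f y)| := by rw [hdiff, abs_mul, abs_of_nonneg hpi]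
        _ ≤ p i * ((d ^ t)⁻¹ * ‖f x - f y‖ ^ t + θ ^ n) := by gcongr; exact ih hfx hfy
        _ = (d ^ t)⁻¹ * (p i * ‖f x - f y‖ ^ t) + p i * θ ^ n := by ring
        _ ≤ (d ^ t)⁻¹ * (s i ^ t * ‖f x - f y‖ ^ t) + θ * θ ^ n := by
          gcongr
          exacts [hps i hi, hpθ i hi]
        _ ≤ (d ^ t)⁻¹ * ‖x - y‖ ^ t + θ ^ (n + 1) := by rw [pow_succ']; gcongr
    · have hdist := hsep i hi j hj hij _ (h.mem_closedBall hfx) _ (h.mem_closedBall hfy)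
      rw [hxi, hyj] at hdist
      have hone : 1 ≤ (d ^ t)⁻¹ * ‖x - y‖ ^ t := by
        rw [inv_mul_eq_div, one_le_div (by positivity)]
        exact Real.rpow_le_rpow hd.le hdist ht.le
      exact (hu.abs_sub_le_one x y).trans (hone.trans (le_add_of_nonneg_right (by positivity)))

end IsCodeFunction

lemma ofReal_le_dimH_of_Icc_subset_closure_image {X : Type*} [MetricSpace X] {A : Set X}
    {u : X → ℝ} {C t : ℝ} (hA : IsCompact A) (ht : 0 < t) (hC : 0 ≤ C)
    (hu : ∀ x ∈ A, ∀ y ∈ A, |u x - u y| ≤ C * dist x y ^ t) (hdense : Icc 0 1 ⊆ closure (u '' A)) :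
    ENNReal.ofReal t ≤ dimH A := by
  have htnn : 0 < t.toNNReal := Real.toNNReal_pos.2 ht
  have hholder : HolderOnWith C.toNNReal t.toNNReal u A := by
    intro x hx y hy
    rw [edist_dist, edist_dist, Real.coe_toNNReal t ht.le,
      ENNReal.ofReal_rpow_of_nonneg dist_nonneg ht.le, Real.dist_eq]
    change _ ≤ ENNReal.ofReal C * _
    rw [← ENNReal.ofReal_mul hC]
    exact ENNReal.ofReal_le_ofReal (hu x hx y hy)
  have hclosed : IsClosed (u '' A) :=
    (hA.image_of_continuousOn (hholder.uniformContinuousOn htnn).continuousOn).isClosed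
  have hone : 1 ≤ dimH (u '' A) :=
    calc (1 : ENNReal) = dimH (Icc (0 : ℝ) 1) := by
          rw [Real.dimH_of_nonempty_interior (by simp), Module.finrank_self, Nat.cast_one]
      _ ≤ dimH (u '' A) := dimH_mono (hclosed.closure_eq ▸ hdense)
  have hdiv := hone.trans (hholder.dimH_image_le htnn)
  rwa [ENNReal.le_div_iff_mul_le (Or.inl (by simpa using ht)) (Or.inl (by simp)), one_mul] at hdiv

lemma IsBranchSystem.le_dimH (h : IsBranchSystem f Ω S ψ c r r') (ht : 0 < t)
    (hs : ∀ i ∈ S, 0 < s i)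
    (hlow : ∀ i ∈ S, ∀ x ∈ ball c r, ∀ y ∈ ball c r, s i * ‖x - y‖ ≤ ‖ψ i x - ψ i y‖)
    (hsum : 1 ≤ ∑ i ∈ S, s i ^ t) : ENNReal.ofReal t ≤ dimH (branchLimitSet f S ψ c r) := by
  set p : ι → ℝ := fun i => s i ^ t / ∑ j ∈ S, s j ^ t with hp
  have hσ : 0 < ∑ j ∈ S, s j ^ t := one_pos.trans_le hsum
  have hp0 : ∀ i ∈ S, 0 < p i := fun i hi => div_pos (Real.rpow_pos_of_pos (hs i hi) _) hσ
  have hpsum : ∑ i ∈ S, p i = 1 := by rw [hp, ← Finset.sum_div, div_self hσ.ne']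
  have hps : ∀ i ∈ S, p i ≤ s i ^ t := fun i hi =>
    div_le_self (Real.rpow_nonneg (hs i hi).le _) hsum
  have hpθ : ∀ i ∈ S, p i ≤ (1 / 2) ^ t := fun i hi => (hps i hi).trans <|
    Real.rpow_le_rpow (hs i hi).le (h.ratio_le_half hi (hlow i hi)) ht.le
  have hθ : Tendsto (fun n : ℕ => (((1 : ℝ) / 2) ^ t) ^ n) atTop (𝓝 0) :=
    tendsto_pow_atTop_nhds_zero_of_lt_one (by positivity)
      (Real.rpow_lt_one (by norm_num) (by norm_num) ht)
  obtain ⟨u, hu⟩ := h.exists_isCodeFunction hp0 hpsum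
  obtain ⟨d, hd, hsep⟩ := h.exists_separation
  refine ofReal_le_dimH_of_Icc_subset_closure_image (C := (d ^ t)⁻¹) (u := u)
    h.isCompact_branchLimitSet ht (by positivity) (fun x hx y hy => ?_) fun y hy => ?_
  · rw [dist_eq_norm]
    exact ge_of_tendsto' (by simpa using hθ.const_add ((d ^ t)⁻¹ * ‖x - y‖ ^ t)) fun n =>
      hu.abs_sub_le_add_pow h ht hs hlow hp0 hps hpθ hd hsep n hx hy
  · refine Metric.mem_closure_iff.2 fun ε hε => ?_
    obtain ⟨n, hn⟩ := (hθ.eventually_lt_const hε).exists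
    obtain ⟨x, hx, hxy⟩ := hu.exists_abs_sub_le h hp0 hpθ hpsum n hy
    exact ⟨u x, mem_image_of_mem _ hx, by rw [dist_comm, Real.dist_eq]; exact hxy.trans_lt hn⟩

end CodeFunction

/-! ### Expanding repellers and the Julia set -/

section Chordal

/-- The inverse of the stereographic projection, by which the chordal distance becomes the
Euclidean distance on the unit sphere. -/
noncomputable def sphereEmb : OnePoint ℂ → EuclideanSpace ℝ (Fin 3)
  | some z => !₂[2 * z.re / (1 + ‖z‖ ^ 2), 2 * z.im / (1 + ‖z‖ ^ 2), (‖z‖ ^ 2 - 1) / (1 + ‖z‖ ^ 2)]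
  | none => !₂[0, 0, 1]

lemma chordal_nonneg (x y : OnePoint ℂ) : 0 ≤ chordal x y := by
  unfold chordal
  split <;> positivity

lemma chordal_eq_dist (x y : OnePoint ℂ) : chordal x y = dist (sphereEmb x) (sphereEmb y) := by
  have hnorm : ∀ z : ℂ, ‖z‖ ^ 2 = z.re ^ 2 + z.im ^ 2 := fun z => by
    rw [Complex.sq_norm, Complex.normSq_apply]; ring
  have hpos : ∀ z : ℂ, 1 + (z.re ^ 2 + z.im ^ 2) ≠ 0 := fun z => by positivity
  rw [EuclideanSpace.dist_eq, ← Real.sqrt_sq (chordal_nonneg x y)]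
  congr 1
  match x, y with
  | some z, some w =>
    have hz := hpos z
    have hw := hpos w
    simp only [chordal, sphereEmb, Fin.sum_univ_three, Real.dist_eq, sq_abs]
    rw [div_pow, mul_pow, mul_pow, Real.sq_sqrt (by positivity), Real.sq_sqrt (by positivity)]
    simp [hnorm]
    field_simp
    ring
  | some z, none | none, some z =>
    have hz := hpos z
    simp only [chordal, sphereEmb, Fin.sum_univ_three, Real.dist_eq, sq_abs]
    rw [div_pow, Real.sq_sqrt (by positivity)]
    simp [hnorm]
    field_simp
    ring
  | none, none => simp [chordal]

lemma chordal_coe_le (a b : ℂ) : chordal (a : OnePoint ℂ) b ≤ 2 * ‖a - b‖ := by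
  change 2 * ‖a - b‖ / (√(1 + ‖a‖ ^ 2) * √(1 + ‖b‖ ^ 2)) ≤ _
  have hone : ∀ x : ℂ, 1 ≤ √(1 + ‖x‖ ^ 2) := fun x =>
    Real.one_le_sqrt.2 (le_add_of_nonneg_right (sq_nonneg _))
  exact div_le_self (by positivity) (one_le_mul_of_one_le_of_one_le (hone a) (hone b))

lemma norm_le_of_chordal_lt {M : ℝ} {a b : ℂ} (ha : ‖a‖ ≤ M)
    (hab : chordal (a : OnePoint ℂ) b < 1 / √(1 + M ^ 2)) : ‖b‖ ≤ 2 * M + 1 := by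
  by_contra! hb
  refine hab.not_ge ?_
  change _ ≤ 2 * ‖a - b‖ / (√(1 + ‖a‖ ^ 2) * √(1 + ‖b‖ ^ 2))
  have hsqrt_a : √(1 + ‖a‖ ^ 2) ≤ √(1 + M ^ 2) := Real.sqrt_le_sqrt (by gcongr)
  have hsqrt_b : √(1 + ‖b‖ ^ 2) ≤ 2 * ‖a - b‖ :=
    calc √(1 + ‖b‖ ^ 2) ≤ 1 + ‖b‖ := by
          rw [Real.sqrt_le_left (by positivity)]
          nlinarith [norm_nonneg b]
      _ ≤ 2 * (‖b‖ - ‖a‖) := by linarith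
      _ ≤ 2 * ‖a - b‖ := by
          rw [norm_sub_rev]
          gcongr
          exact norm_sub_norm_le _ _
  rw [div_le_div_iff₀ (by positivity) (by positivity), one_mul, mul_comm]
  gcongr

end Chordal

section Julia

open Metric

lemma IsNormalOn.exists_bounded_subseq {F : ℕ → ℂ → ℂ} {U : Set ℂ} {z : ℂ} {M : ℝ}
    (hF : IsNormalOn F U) (hU : U ∈ 𝓝 z) (hcont : ∀ n, ContinuousAt (F n) z)
    (hM : ∀ n, ‖F n z‖ ≤ M) :
    ∃ k : ℕ → ℕ, StrictMono k ∧ ∃ ρ > 0, closedBall z ρ ⊆ U ∧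
      ∀ᶠ j in atTop, ∀ w ∈ closedBall z ρ, ‖F (k j) w‖ ≤ 2 * M + 1 := by
  obtain ⟨k, hk, G, hG⟩ := hF id
  simp only [id] at hG
  obtain ⟨ρ, hρ, hρU⟩ := nhds_basis_closedBall.mem_iff.1 hU
  obtain ⟨ε, hε, hεM⟩ : ∃ ε > 0, 5 * ε = 1 / √(1 + M ^ 2) :=
    ⟨1 / √(1 + M ^ 2) / 5, by positivity, by ring⟩
  have hconv := hG _ hρU (isCompact_closedBall z ρ) ε hε
  obtain ⟨j₀, hj₀⟩ := hconv.exists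
  obtain ⟨ρ', hρ', hball⟩ := nhds_basis_closedBall.mem_iff.1
    (hcont (k j₀) (ball_mem_nhds _ (half_pos hε)))
  refine ⟨k, hk, min ρ ρ', lt_min hρ hρ',
    (closedBall_subset_closedBall (min_le_left _ _)).trans hρU, ?_⟩
  filter_upwards [hconv] with j hj w hw
  refine norm_le_of_chordal_lt (hM (k j)) ?_
  have hwρ : w ∈ closedBall z ρ := closedBall_subset_closedBall (min_le_left _ _) hw
  have hzρ : z ∈ closedBall z ρ := mem_closedBall_self hρ.le
  have hw₀ : ‖F (k j₀) z - F (k j₀) w‖ < ε / 2 :=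
    mem_ball_iff_norm'.1 (hball (closedBall_subset_closedBall (min_le_right _ _) hw))
  have hclose := (chordal_coe_le (F (k j₀) z) (F (k j₀) w)).trans_lt (by linarith : _ < ε)
  have hjz := hj z hzρ
  have hjw := hj w hwρ
  have hj₀z := hj₀ z hzρ
  have hj₀w := hj₀ w hwρ
  simp only [chordal_eq_dist] at hclose hjz hjw hj₀z hj₀w ⊢
  rw [← hεM]
  linarith [dist_triangle4_right (sphereEmb (F (k j) z)) (sphereEmb (F (k j) w))
      (sphereEmb (G z)) (sphereEmb (G w)),
    dist_triangle4_left (sphereEmb (F (k j₀) z)) (sphereEmb (F (k j₀) w)) (sphereEmb (G z))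
      (sphereEmb (G w))]

lemma differentiableAt_of_notMem_poles {f : ℂ → ℂ} (hf : MeromorphicNFOn f univ) {z : ℂ}
    (hz : z ∉ poles f) : DifferentiableAt ℂ f z :=
  ((hf (mem_univ z)).meromorphicOrderAt_nonneg_iff_analyticAt.1 (not_lt.1 hz)).differentiableAt

lemma differentiableOn_iterate {f : ℂ → ℂ} {U : Set ℂ} (hf : MeromorphicNFOn f univ)
    (hU : ∀ w ∈ U, ∀ n : ℕ, f^[n] w ∉ poles f) (n : ℕ) : DifferentiableOn ℂ f^[n] U := by
  induction n with
  | zero => exact differentiableOn_id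
  | succ n ih =>
    rw [Function.iterate_succ']
    exact fun w hw =>
      (differentiableAt_of_notMem_poles hf (hU w hw n)).comp_differentiableWithinAt w (ih w hw)

lemma IsExpandingRepeller.iterate_mem {f : ℂ → ℂ} {D X : Set ℂ} (hX : IsExpandingRepeller f D X)
    {z : ℂ} (hz : z ∈ X) (n : ℕ) : f^[n] z ∈ X :=
  (mapsTo_iff_image_subset.2 hX.image_eq.subset).iterate n hz

/-- The orbit of a point of the repeller is bounded, so a locally convergent subsequence of the
iterates would be locally bounded; by Cauchy's estimate its derivatives could not grow. -/
lemma IsExpandingRepeller.subset_julia {f : ℂ → ℂ} {D X : Set ℂ} (hf : MeromorphicNFOn f univ)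
    (hX : IsExpandingRepeller f D X) : X ⊆ julia f := by
  rintro z hz ⟨U, hUo, hzU, hpoles, hnormal⟩
  have hUz := hUo.mem_nhds hzU
  have hdiff := differentiableOn_iterate hf hpoles
  obtain ⟨M, hM⟩ := isBounded_iff_forall_norm_le.1 hX.isCompact.isBounded
  obtain ⟨k, hk, ρ, hρ, hρU, hbound⟩ := hnormal.exists_bounded_subseq hUz
    (fun n => ((hdiff n).differentiableAt hUz).continuousAt) fun n => hM _ (hX.iterate_mem hz n)
  obtain ⟨c, r, hc, hr, hexp⟩ := hX.expanding
  have hgrow := (tendsto_pow_atTop_atTop_of_one_lt hr).const_mul_atTop hc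
  obtain ⟨j, hj, hjM⟩ := ((hgrow.eventually_gt_atTop ((2 * M + 1) / ρ)).and hbound).exists
  have hcauchy : ‖deriv f^[k j] z‖ ≤ (2 * M + 1) / ρ :=
    Complex.norm_deriv_le_of_forall_mem_sphere_norm_le hρ
      (((hdiff (k j)).mono hρU).diffContOnCl_ball subset_rfl) fun w hw =>
        hjM w (sphere_subset_closedBall hw)
  refine hj.not_ge (le_trans ?_ ((hexp (k j) z hz).trans hcauchy))
  gcongr
  exacts [hr.le, hk.id_le j]

end Julia

/-! ### Hölder tracts -/

section Square

variable {R R' : ℝ} {z w : ℂ}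

lemma Q_subset_rightHalfPlane (R : ℝ) : Q R ⊆ rightHalfPlane := fun _ hz => hz.1

lemma Q_mono (hR : R ≤ R') : Q R ⊆ Q R' := fun _ hz =>
  ⟨hz.1, by linarith [hz.2.1], by linarith [hz.2.2.1], by linarith [hz.2.2.2]⟩

lemma ofReal_mem_Q {x : ℝ} (hx : 0 < x) (hxR : x < 2 * R) : (x : ℂ) ∈ Q R := by
  simp only [Q, mem_ofPred_eq, Complex.ofReal_re, Complex.ofReal_im]
  exact ⟨hx, hxR, by linarith, by linarith⟩

lemma norm_sub_le_of_mem_Q (hz : z ∈ Q R) (hw : w ∈ Q R) : ‖z - w‖ ≤ 4 * R := by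
  obtain ⟨hz₁, hz₂, hz₃, hz₄⟩ := hz
  obtain ⟨hw₁, hw₂, hw₃, hw₄⟩ := hw
  calc ‖z - w‖ ≤ |z.re - w.re| + |z.im - w.im| := Complex.norm_le_abs_re_add_abs_im _
    _ ≤ 2 * R + 2 * R :=
      add_le_add (abs_le.2 ⟨by linarith, by linarith⟩) (abs_le.2 ⟨by linarith, by linarith⟩)
    _ = 4 * R := by ring

lemma rpow_norm_sub_div_le_of_mem_Q (hR : 0 < R) {α : ℝ} (hα : 0 ≤ α) (hα1 : α ≤ 1)
    (hz : z ∈ Q (2 * R)) (hw : w ∈ Q (2 * R)) : (‖z - w‖ / R) ^ α ≤ 8 := by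
  have hle : ‖z - w‖ / R ≤ 8 := by
    rw [div_le_iff₀ hR]
    linarith [norm_sub_le_of_mem_Q hz hw]
  calc (‖z - w‖ / R) ^ α ≤ 8 ^ α := Real.rpow_le_rpow (by positivity) hle hα
    _ ≤ 8 ^ (1 : ℝ) := Real.rpow_le_rpow_of_exponent_le (by norm_num) hα1
    _ = 8 := Real.rpow_one 8

lemma isBounded_image_Q {φ : ℂ → ℂ} {C : ℝ} (hosc : ∀ z ∈ Q R, ∀ w ∈ Q R, ‖φ z - φ w‖ ≤ C) :
    Bornology.IsBounded (φ '' Q R) := by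
  refine Metric.isBounded_iff.2 ⟨C, ?_⟩
  rintro _ ⟨z, hz, rfl⟩ _ ⟨w, hw, rfl⟩
  exact (dist_eq_norm _ _).trans_le (hosc z hz w hw)

lemma diamTract_le {φ : ℂ → ℂ} {C : ℝ} (hC : 0 ≤ C)
    (hosc : ∀ z ∈ Q R, ∀ w ∈ Q R, ‖φ z - φ w‖ ≤ C) : diamTract φ R ≤ C := by
  refine Metric.diam_le_of_forall_dist_le hC ?_
  rintro _ ⟨z, hz, rfl⟩ _ ⟨w, hw, rfl⟩
  exact (dist_eq_norm _ _).trans_le (hosc z hz w hw)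

lemma div_mem_Q_one (hR : 0 < R) (hz : z ∈ Q R) : z / (R : ℂ) ∈ Q 1 := by
  obtain ⟨hz₁, hz₂, hz₃, hz₄⟩ := hz
  simp only [Q, mem_ofPred_eq, Complex.div_ofReal_re, Complex.div_ofReal_im]
  refine ⟨by positivity, ?_, ?_, ?_⟩
  · rwa [mul_one, div_lt_iff₀ hR]
  · rwa [lt_div_iff₀ hR, neg_one_mul]
  · rwa [div_lt_iff₀ hR, one_mul]

lemma rescale_div (φ : ℂ → ℂ) (hR : R ≠ 0) (z : ℂ) : rescale φ R (z / (R : ℂ)) = φ z := by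
  rw [rescale, mul_div_cancel₀ _ (Complex.ofReal_ne_zero.2 hR)]

lemma kappa_pos : 0 < kappa := by unfold kappa; positivity

lemma kappa_lt_one : kappa < 1 :=
  inv_lt_one_of_one_lt₀ (lt_add_of_pos_right 1 Real.two_pi_pos)

end Square

/-- The scale `R |φ'(R)|` of the set `φ (Q_R)`: it is comparable to its diameter. -/
noncomputable def tractScale (φ : ℂ → ℂ) (R : ℝ) : ℝ := R * ‖deriv φ (R : ℂ)‖

/-- Quantitative form of the Hölder property of a tract, in terms of the scale `R |φ'(R)|` and
for `R ≥ R₀`. -/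
structure TractBounds (φ : ℂ → ℂ) (M m α R₀ : ℝ) : Prop where
  one_le_M : 1 ≤ M
  m_pos : 0 < m
  alpha_pos : 0 < α
  one_lt : 1 < R₀
  scale_pos : ∀ R, R₀ ≤ R → 0 < tractScale φ R
  holder : ∀ R, R₀ ≤ R → ∀ z₁ ∈ Q (2 * R), ∀ z₂ ∈ Q (2 * R),
    ‖φ z₁ - φ z₂‖ ≤ M * tractScale φ R * (‖z₁ - z₂‖ / R) ^ α
  diam_le : ∀ R, R₀ ≤ R → diamTract φ R ≤ M * tractScale φ R
  le_diam : ∀ R, R₀ ≤ R → tractScale φ R ≤ 2 * diamTract φ R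
  norm_le : ∀ R, R₀ ≤ R → ∀ z ∈ Q (2 * R), ‖φ z‖ ≤ M * tractScale φ R
  le_norm : ∀ R, R₀ ≤ R → ∀ z ∈ Q (2 * R), kappa * R / 2 ≤ |z.im| → m * tractScale φ R ≤ ‖φ z‖
  tendsto : Tendsto (tractScale φ) atTop atTop
  scale_le : ∀ R, R₀ ≤ R → tractScale φ R ≤ R ^ (distortionConst + 2)

namespace IsTractModel

variable {Ω : Set ℂ} {τ φ : ℂ → ℂ} {R : ℝ}

lemma deriv_rescale (h : IsTractModel Ω τ φ) {z : ℂ} (hz : (R : ℂ) * z ∈ rightHalfPlane) :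
    deriv (rescale φ R) z = R * deriv φ (R * z) := by
  have hmul : HasDerivAt (fun z : ℂ => (R : ℂ) * z) (R : ℂ) z := hasDerivAt_const_mul _
  rw [mul_comm]
  exact ((h.hasDerivAt hz).comp z hmul).deriv

lemma tendsto_norm_comp (h : IsTractModel Ω τ φ) {γ : ℝ → ℂ}
    (hγ : Tendsto (fun R => ‖γ R‖) atTop atTop) (hmem : ∀ᶠ R in atTop, γ R ∈ rightHalfPlane) :
    Tendsto (fun R => ‖φ (γ R)‖) atTop atTop :=
  tendsto_norm_atTop_iff_cobounded.2 <| h.proper.comp <|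
    tendsto_inf.2 ⟨tendsto_norm_atTop_iff_cobounded.1 hγ, tendsto_principal.2 hmem⟩

lemma tendsto_norm_ofReal (h : IsTractModel Ω τ φ) :
    Tendsto (fun R : ℝ => ‖φ (R : ℂ)‖) atTop atTop :=
  h.tendsto_norm_comp (by simpa using tendsto_abs_atTop_atTop)
    ((eventually_gt_atTop 0).mono fun _ => ofReal_mem_rightHalfPlane.2)

lemma tractScale_pos (h : IsTractModel Ω τ φ) (hR : 0 < R) : 0 < tractScale φ R :=
  mul_pos hR (h.norm_deriv_pos hR)

lemma norm_deriv_ofReal_le (h : IsTractModel Ω τ φ) {x y : ℝ} (hx : 0 < x) (hy : 0 < y) :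
    ‖deriv φ y‖ ≤ ‖deriv φ x‖ * Real.exp (distortionConst * |Real.log (y / x)|) := by
  simpa using h.norm_deriv_le_mul_exp (z := x) (w := y) hx hy

lemma norm_deriv_two_mul_le (h : IsTractModel Ω τ φ) (hR : 0 < R) :
    ‖deriv φ ((2 * R : ℝ) : ℂ)‖ ≤ 2 ^ distortionConst * ‖deriv φ (R : ℂ)‖ := by
  have hle := h.norm_deriv_ofReal_le hR (mul_pos two_pos hR)
  rw [mul_div_cancel_right₀ _ hR.ne', abs_of_nonneg (Real.log_nonneg one_le_two),
    mul_comm distortionConst, ← Real.rpow_def_of_pos two_pos] at hle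
  exact hle.trans_eq (mul_comm _ _)

lemma tractScale_le_two_mul (h : IsTractModel Ω τ φ) (hR : 0 < R) :
    tractScale φ R ≤ 2 ^ distortionConst * tractScale φ (2 * R) := by
  have hle := h.norm_deriv_ofReal_le (mul_pos two_pos hR) hR
  rw [← inv_div, mul_div_cancel_right₀ _ hR.ne', Real.log_inv, abs_neg,
    abs_of_nonneg (Real.log_nonneg one_le_two), mul_comm, mul_comm distortionConst,
    ← Real.rpow_def_of_pos two_pos] at hle
  calc tractScale φ R ≤ R * (2 ^ distortionConst * ‖deriv φ ((2 * R : ℝ) : ℂ)‖) := by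
        unfold tractScale
        gcongr
    _ ≤ 2 * (R * (2 ^ distortionConst * ‖deriv φ ((2 * R : ℝ) : ℂ)‖)) :=
        le_mul_of_one_le_left (by positivity) one_le_two
    _ = 2 ^ distortionConst * tractScale φ (2 * R) := by unfold tractScale; ring

lemma tractScale_le_rpow (h : IsTractModel Ω τ φ) (hR : 1 ≤ R) (hφR : ‖deriv φ 1‖ ≤ R) :
    tractScale φ R ≤ R ^ (distortionConst + 2) := by
  have hR0 : 0 < R := one_pos.trans_le hR
  have hle := h.norm_deriv_ofReal_le one_pos hR0
  rw [div_one, abs_of_nonneg (Real.log_nonneg hR), mul_comm distortionConst,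
    ← Real.rpow_def_of_pos hR0, Complex.ofReal_one] at hle
  calc tractScale φ R ≤ R * (R * R ^ distortionConst) := by
        unfold tractScale
        gcongr
        exact hle.trans (by gcongr)
    _ = R ^ (distortionConst + 2) := by
        rw [Real.rpow_add hR0, Real.rpow_two]
        ring

lemma norm_sub_le_of_rescale (h : IsTractModel Ω τ φ) (hR : 0 < R) {H α : ℝ} (hH : 0 ≤ H)
    (hα : 0 ≤ α) (hholder : ∀ z₁ ∈ Q 1, ∀ z₂ ∈ Q 1,
      ‖rescale φ (2 * R) z₁ - rescale φ (2 * R) z₂‖ ≤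
        H * ‖deriv (rescale φ (2 * R)) 1‖ * ‖z₁ - z₂‖ ^ α)
    {z₁ z₂ : ℂ} (hz₁ : z₁ ∈ Q (2 * R)) (hz₂ : z₂ ∈ Q (2 * R)) :
    ‖φ z₁ - φ z₂‖ ≤ 2 * H * 2 ^ distortionConst * tractScale φ R * (‖z₁ - z₂‖ / R) ^ α := by
  have h2R : 0 < 2 * R := by positivity
  have hle := hholder _ (div_mem_Q_one h2R hz₁) _ (div_mem_Q_one h2R hz₂)
  rw [rescale_div φ h2R.ne', rescale_div φ h2R.ne', h.deriv_rescale (by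
    rw [mul_one]; exact h2R), mul_one, norm_mul, Complex.norm_of_nonneg h2R.le, ← sub_div,
    norm_div, Complex.norm_of_nonneg h2R.le] at hle
  calc ‖φ z₁ - φ z₂‖
      ≤ H * (2 * R * ‖deriv φ ((2 * R : ℝ) : ℂ)‖) * (‖z₁ - z₂‖ / (2 * R)) ^ α := hle
    _ ≤ H * (2 * R * (2 ^ distortionConst * ‖deriv φ (R : ℂ)‖)) * (‖z₁ - z₂‖ / R) ^ α := by
        gcongr
        · exact h.norm_deriv_two_mul_le hR
        · linarith
    _ = _ := by unfold tractScale; ring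

lemma tractScale_le_two_mul_diamTract (h : IsTractModel Ω τ φ) (hR : 0 < R)
    (hbdd : Bornology.IsBounded (φ '' Q R)) : tractScale φ R ≤ 2 * diamTract φ R := by
  have hball : Metric.closedBall (R : ℂ) (R / 2) ⊆ Q R := by
    intro w hw
    rw [mem_closedBall_iff_norm] at hw
    have hre := abs_le.1 ((Complex.abs_re_le_norm _).trans hw)
    have him := abs_le.1 ((Complex.abs_im_le_norm _).trans hw)
    simp only [Complex.sub_re, Complex.sub_im, Complex.ofReal_re, Complex.ofReal_im] at hre him
    exact ⟨by linarith, by linarith, by linarith, by linarith⟩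
  have hdiff : DifferentiableOn ℂ (fun z => φ z - φ (R : ℂ)) (Metric.closedBall (R : ℂ) (R / 2)) :=
    (h.holo_inv.mono (hball.trans (Q_subset_rightHalfPlane R))).sub_const _
  have hcauchy := Complex.norm_deriv_le_of_forall_mem_sphere_norm_le (C := diamTract φ R)
    (half_pos hR) (hdiff.diffContOnCl_ball subset_rfl) (by
      intro z hz
      rw [← dist_eq_norm]
      exact Metric.dist_le_diam_of_mem hbdd
        (mem_image_of_mem _ (hball (Metric.sphere_subset_closedBall hz)))
        (mem_image_of_mem _ (ofReal_mem_Q hR (by linarith))))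
  rw [deriv_sub_const, le_div_iff₀ (by positivity)] at hcauchy
  rw [tractScale]
  linarith

lemma mul_tractScale_le_norm (h : IsTractModel Ω τ φ) (hR : 0 < R) {m : ℝ} (hm : 0 ≤ m)
    (hlow : ∀ z ∈ Q 1 \ Q (kappa / 4), m * diamTract φ (2 * R) ≤ ‖rescale φ (2 * R) z‖)
    (hdiam : tractScale φ (2 * R) ≤ 2 * diamTract φ (2 * R)) {z : ℂ} (hz : z ∈ Q (2 * R))
    (him : kappa * R / 2 ≤ |z.im|) :
    m / (2 * 2 ^ distortionConst) * tractScale φ R ≤ ‖φ z‖ := by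
  have h2R : 0 < 2 * R := by positivity
  have hzκ : z / ((2 * R : ℝ) : ℂ) ∉ Q (kappa / 4) := by
    rintro ⟨-, -, hlt, hgt⟩
    have hlt := abs_lt.2 ⟨hlt, hgt⟩
    rw [Complex.div_ofReal_im, abs_div, abs_of_pos h2R, div_lt_iff₀ h2R] at hlt
    linarith
  calc m / (2 * 2 ^ distortionConst) * tractScale φ R
      ≤ m / (2 * 2 ^ distortionConst) * (2 ^ distortionConst * tractScale φ (2 * R)) := by
        gcongr
        exact h.tractScale_le_two_mul hR
    _ = m * (tractScale φ (2 * R) / 2) := by field_simp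
    _ ≤ m * diamTract φ (2 * R) := by gcongr; linarith
    _ ≤ ‖φ z‖ := by
        rw [← rescale_div φ h2R.ne' z]
        exact hlow _ ⟨div_mem_Q_one h2R hz, hzκ⟩

lemma tendsto_tractScale (h : IsTractModel Ω τ φ) {C : ℝ} (hC : 0 < C)
    (hosc : ∀ᶠ R in atTop, ∀ z₁ ∈ Q (2 * R), ∀ z₂ ∈ Q (2 * R),
      ‖φ z₁ - φ z₂‖ ≤ C * tractScale φ R) : Tendsto (tractScale φ) atTop atTop := by
  have hnorm : Tendsto (fun R : ℝ => C⁻¹ * (‖φ (R : ℂ)‖ - ‖φ (1 : ℝ)‖)) atTop atTop :=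
    (tendsto_atTop_add_const_right _ _ h.tendsto_norm_ofReal).const_mul_atTop (inv_pos.2 hC)
  refine tendsto_atTop_mono' _ ?_ hnorm
  filter_upwards [hosc, eventually_ge_atTop 1] with R hR hR1
  rw [inv_mul_le_iff₀ hC]
  exact (norm_sub_norm_le _ _).trans
    (hR _ (ofReal_mem_Q (by linarith) (by linarith)) _ (ofReal_mem_Q one_pos (by linarith)))

lemma exists_norm_sub_le (h : IsTractModel Ω τ φ) (hφ : IsHolder φ) :
    ∃ C m α R₁ : ℝ, 0 < C ∧ 0 < m ∧ 0 < α ∧ 1 ≤ R₁ ∧ ∀ R, R₁ ≤ R →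
      (∀ z₁ ∈ Q (2 * R), ∀ z₂ ∈ Q (2 * R),
        ‖φ z₁ - φ z₂‖ ≤ C * tractScale φ R * (‖z₁ - z₂‖ / R) ^ α) ∧
      (∀ z₁ ∈ Q (2 * R), ∀ z₂ ∈ Q (2 * R), ‖φ z₁ - φ z₂‖ ≤ C * tractScale φ R) ∧
      ∀ z ∈ Q 1 \ Q (kappa / 4), m * diamTract φ (2 * R) ≤ ‖rescale φ (2 * R) z‖ := by
  obtain ⟨H, α, hH, hα, hα1, hholder⟩ := hφ
  obtain ⟨m, hm, R₁, hR₁, hbounds⟩ :=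
    hholder (kappa / 4) (by linarith [kappa_pos]) (by linarith [kappa_lt_one])
  refine ⟨8 * (2 * H * 2 ^ distortionConst), m, α, R₁, by positivity, hm, hα, hR₁, fun R hR => ?_⟩
  have hR0 : 0 < R := by linarith
  have hs := h.tractScale_pos hR0
  obtain ⟨hsub, hlow⟩ := hbounds (2 * R) (by linarith)
  have hle {z₁ z₂ : ℂ} (hz₁ : z₁ ∈ Q (2 * R)) (hz₂ : z₂ ∈ Q (2 * R)) :=
    h.norm_sub_le_of_rescale hR0 hH.le hα.le hsub hz₁ hz₂
  refine ⟨fun z₁ hz₁ z₂ hz₂ => ?_, fun z₁ hz₁ z₂ hz₂ => ?_, hlow⟩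
  · calc ‖φ z₁ - φ z₂‖
        ≤ 2 * H * 2 ^ distortionConst * tractScale φ R * (‖z₁ - z₂‖ / R) ^ α := hle hz₁ hz₂
      _ ≤ 8 * (2 * H * 2 ^ distortionConst * tractScale φ R * (‖z₁ - z₂‖ / R) ^ α) :=
          le_mul_of_one_le_left (by positivity) (by norm_num)
      _ = _ := by ring
  · calc ‖φ z₁ - φ z₂‖ ≤ 2 * H * 2 ^ distortionConst * tractScale φ R * 8 := by
          refine (hle hz₁ hz₂).trans ?_
          gcongr
          exact rpow_norm_sub_div_le_of_mem_Q hR0 hα.le hα1 hz₁ hz₂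
      _ = 8 * (2 * H * 2 ^ distortionConst) * tractScale φ R := by ring

lemma exists_tractBounds (h : IsTractModel Ω τ φ) (hφ : IsHolder φ) :
    ∃ M m α R₀ : ℝ, TractBounds φ M m α R₀ := by
  obtain ⟨C, m, α, R₁, hC, hm, hα, hR₁, hbounds⟩ := h.exists_norm_sub_le hφ
  have hoscQ : ∀ R, R₁ ≤ R → ∀ z₁ ∈ Q R, ∀ z₂ ∈ Q R, ‖φ z₁ - φ z₂‖ ≤ C * tractScale φ R :=
    fun R hR z₁ hz₁ z₂ hz₂ => have hQ : Q R ⊆ Q (2 * R) := Q_mono (by linarith)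
      (hbounds R hR).2.1 z₁ (hQ hz₁) z₂ (hQ hz₂)
  have hdiam : ∀ R, R₁ ≤ R → tractScale φ R ≤ 2 * diamTract φ R := fun R hR =>
    h.tractScale_le_two_mul_diamTract (by linarith) (isBounded_image_Q (hoscQ R hR))
  have htendsto : Tendsto (tractScale φ) atTop atTop := h.tendsto_tractScale hC <|
    (eventually_ge_atTop R₁).mono fun R hR => (hbounds R hR).2.1
  obtain ⟨R₂, hR₂⟩ := eventually_atTop.1 (htendsto.eventually_ge_atTop ‖φ 1‖)
  refine ⟨C + 1, m / (2 * 2 ^ distortionConst), α, R₁ + max 1 (max R₂ ‖deriv φ 1‖), ?_⟩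
  have hR₀ : ∀ R, R₁ + max 1 (max R₂ ‖deriv φ 1‖) ≤ R → R₁ ≤ R ∧ R₂ ≤ R ∧ ‖deriv φ 1‖ ≤ R := by
    grind
  have hscale : ∀ R, R₁ ≤ R → 0 < tractScale φ R := fun R hR => h.tractScale_pos (by linarith)
  refine ⟨by linarith, by positivity, hα, by grind, fun R hR => hscale R (hR₀ R hR).1,
    fun R hR z₁ hz₁ z₂ hz₂ => ?_, fun R hR => ?_, fun R hR => hdiam R (hR₀ R hR).1,
    fun R hR z hz => ?_, fun R hR z hz him => ?_, htendsto, fun R hR => ?_⟩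
  all_goals
    obtain ⟨hR₁R, hR₂R, hφR⟩ := hR₀ R hR
    have hs := hscale R hR₁R
    obtain ⟨hsub, hosc, hlow⟩ := hbounds R hR₁R
  · refine (hsub z₁ hz₁ z₂ hz₂).trans ?_
    have hR0 : 0 < R := by linarith
    gcongr
    linarith
  · exact (diamTract_le (by positivity) (hoscQ R hR₁R)).trans (by linarith)
  · have h1 : (1 : ℂ) ∈ Q (2 * R) := by
      simpa using ofReal_mem_Q (R := 2 * R) one_pos (by linarith)
    calc ‖φ z‖ ≤ ‖φ z - φ 1‖ + ‖φ 1‖ := by simpa using norm_add_le (φ z - φ 1) (φ 1)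
      _ ≤ C * tractScale φ R + tractScale φ R := add_le_add (hosc z hz 1 h1) (hR₂ R hR₂R)
      _ = (C + 1) * tractScale φ R := by ring
  · exact h.mul_tractScale_le_norm (by linarith) hm.le hlow (hdiam (2 * R) (by linarith)) hz him
  · exact h.tractScale_le_rpow (by linarith) hφR

end IsTractModel

/-! ### The integral means spectrum -/

/-- The modulus `|g_R'(1/R + iy)|`, written in terms of `φ'(1 + iRy)`. -/
noncomputable def gSpeed (φ : ℂ → ℂ) (R y : ℝ) : ℝ :=
  R * ‖deriv φ (1 + ((R * y : ℝ) : ℂ) * Complex.I)‖ / diamTract φ R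

lemma one_add_mul_I_mem_rightHalfPlane (s : ℝ) : 1 + (s : ℂ) * Complex.I ∈ rightHalfPlane := by
  simp [rightHalfPlane]

lemma meanI_zero (φ : ℂ → ℂ) (R : ℝ) : meanI φ R 0 = 1 - kappa := by
  simp only [meanI, segMean, Real.rpow_zero, intervalIntegral.integral_const, smul_eq_mul, mul_one]
  rw [neg_sub_neg, max_self]

lemma tendsto_betaR_zero (φ : ℂ → ℂ) : Tendsto (fun R => betaR φ R 0) atTop (𝓝 0) := by
  simp only [betaR, meanI_zero]
  exact Real.tendsto_log_atTop.const_div_atTop _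

namespace IsTractModel

variable {Ω : Set ℂ} {τ φ : ℂ → ℂ} {R : ℝ}

lemma norm_deriv_g (h : IsTractModel Ω τ φ) (hR : 0 < R) (y : ℝ) :
    ‖deriv (g φ R) (((1 / R : ℝ) : ℂ) + (y : ℂ) * Complex.I)‖ = gSpeed φ R y := by
  have hmul : (R : ℂ) * (((1 / R : ℝ) : ℂ) + (y : ℂ) * Complex.I) =
      1 + ((R * y : ℝ) : ℂ) * Complex.I := by
    have := Complex.ofReal_ne_zero.2 hR.ne'
    push_cast
    field_simp
  have hderiv := h.deriv_rescale (hmul ▸ one_add_mul_I_mem_rightHalfPlane _)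
  rw [hmul] at hderiv
  unfold g
  rw [deriv_div_const, hderiv, norm_div, norm_mul, Complex.norm_of_nonneg hR.le,
    Complex.norm_of_nonneg (r := diamTract φ R) Metric.diam_nonneg, gSpeed]

lemma continuous_gSpeed (h : IsTractModel Ω τ φ) (R : ℝ) : Continuous (gSpeed φ R) := by
  refine Continuous.div_const (continuous_const.mul (Continuous.norm ?_)) _
  exact h.differentiableOn_deriv.continuousOn.comp_continuous (by fun_prop)
    fun y => one_add_mul_I_mem_rightHalfPlane _

lemma segMean_eq (h : IsTractModel Ω τ φ) (hR : 0 < R) (t a b : ℝ) :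
    segMean φ R t a b = ∫ y in a..b, gSpeed φ R y ^ t := by
  simp only [segMean, h.norm_deriv_g hR]

lemma norm_deriv_ofReal_le_mul_norm_deriv_one_add (h : IsTractModel Ω τ φ) (hR : 1 ≤ R) {s : ℝ}
    (hs : |s| ≤ R) : ‖deriv φ (R : ℂ)‖ ≤
      ‖deriv φ (1 + (s : ℂ) * Complex.I)‖ * (R ^ distortionConst * Real.exp distortionConst) := by
  have hR0 : 0 < R := one_pos.trans_le hR
  have hle := h.norm_deriv_le_mul_exp (one_add_mul_I_mem_rightHalfPlane s)
    (ofReal_mem_rightHalfPlane.2 hR0)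
  simp only [Complex.add_re, Complex.one_re, Complex.re_ofReal_mul, Complex.I_re, mul_zero,
    add_zero, Complex.add_im, Complex.one_im, Complex.im_ofReal_mul, Complex.I_im, mul_one,
    zero_add, Complex.ofReal_re, Complex.ofReal_im, div_one, zero_sub, abs_neg,
    abs_of_nonneg (Real.log_nonneg hR)] at hle
  refine hle.trans ?_
  rw [Real.rpow_def_of_pos hR0, ← Real.exp_add]
  have hsR : |s| / R ≤ 1 := (div_le_one hR0).2 hs
  gcongr
  nlinarith [distortionConst_pos]

end IsTractModel

namespace TractBounds

variable {Ω : Set ℂ} {τ φ : ℂ → ℂ} {M m α R₀ R : ℝ}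

lemma diam_pos (hb : TractBounds φ M m α R₀) (hR : R₀ ≤ R) : 0 < diamTract φ R := by
  linarith [hb.scale_pos R hR, hb.le_diam R hR]

lemma norm_deriv_le (hb : TractBounds φ M m α R₀) (h : IsTractModel Ω τ φ) (hR : R₀ ≤ R) {z : ℂ}
    (hre : 1 ≤ z.re) (hreR : z.re ≤ 3 * R) (him : |z.im| ≤ 3 / 2 * R) :
    ‖deriv φ z‖ ≤ 2 * M * tractScale φ R * (1 / R) ^ α := by
  have hR1 : 1 < R := hb.one_lt.trans_le hR
  have hball : Metric.closedBall z (1 / 2) ⊆ Q (2 * R) := by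
    intro w hw
    rw [mem_closedBall_iff_norm] at hw
    have hwre := abs_le.1 ((Complex.abs_re_le_norm _).trans hw)
    have hwim := abs_le.1 ((Complex.abs_im_le_norm _).trans hw)
    have hzim := abs_le.1 him
    simp only [Complex.sub_re, Complex.sub_im] at hwre hwim
    exact ⟨by linarith, by linarith, by linarith, by linarith⟩
  have hs := hb.scale_pos R hR
  have hM := hb.one_le_M
  have hα := hb.alpha_pos
  have hdiff : DifferentiableOn ℂ (fun w => φ w - φ z) (Metric.closedBall z (1 / 2)) :=
    (h.holo_inv.mono (hball.trans (Q_subset_rightHalfPlane _))).sub_const _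
  have hcauchy := Complex.norm_deriv_le_of_forall_mem_sphere_norm_le
    (C := M * tractScale φ R * (1 / R) ^ α) one_half_pos (hdiff.diffContOnCl_ball subset_rfl)
    fun w hw => (hb.holder R hR w (hball (Metric.sphere_subset_closedBall hw)) z
      (hball (Metric.mem_closedBall_self one_half_pos.le))).trans (by
        rw [mem_sphere_iff_norm.1 hw]
        gcongr
        norm_num)
  rw [deriv_sub_const] at hcauchy
  linarith

lemma eventually_rpow_le_gSpeed (hb : TractBounds φ M m α R₀) (h : IsTractModel Ω τ φ) :
    ∀ᶠ R in atTop, ∀ y : ℝ, |y| ≤ 1 → R ^ (-(distortionConst + 1)) ≤ gSpeed φ R y := by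
  filter_upwards [eventually_ge_atTop (M * Real.exp distortionConst), eventually_ge_atTop R₀]
    with R hRM hR y hy
  have hR1 : 1 < R := hb.one_lt.trans_le hR
  have hR0 : 0 < R := by linarith
  have hM := hb.one_le_M
  have hyR : |R * y| ≤ R := by
    rw [abs_mul, abs_of_pos hR0]
    exact mul_le_of_le_one_right hR0.le hy
  set d := ‖deriv φ (1 + ((R * y : ℝ) : ℂ) * Complex.I)‖ with hd
  rw [gSpeed, ← hd, le_div_iff₀ (hb.diam_pos hR), Real.rpow_neg hR0.le,
    inv_mul_le_iff₀ (by positivity)]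
  calc diamTract φ R ≤ M * (R * ‖deriv φ (R : ℂ)‖) := hb.diam_le R hR
    _ ≤ M * (R * (d * (R ^ distortionConst * Real.exp distortionConst))) := by
        gcongr
        exact h.norm_deriv_ofReal_le_mul_norm_deriv_one_add hR1.le hyR
    _ = R ^ distortionConst * (M * Real.exp distortionConst) * (R * d) := by ring
    _ ≤ R ^ distortionConst * R * (R * d) := by gcongr
    _ = R ^ (distortionConst + 1) * (R * d) := by rw [Real.rpow_add_one hR0.ne']

lemma eventually_gSpeed_le_rpow (hb : TractBounds φ M m α R₀) (h : IsTractModel Ω τ φ) :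
    ∀ᶠ R in atTop, ∀ y : ℝ, |y| ≤ 1 → gSpeed φ R y ≤ R ^ (1 - α / 2) := by
  have hM := hb.one_le_M
  have hα := hb.alpha_pos
  have hlarge : ∀ᶠ R : ℝ in atTop, 4 * M ≤ R ^ (α / 2) :=
    (tendsto_rpow_atTop (by positivity)).eventually_ge_atTop _
  filter_upwards [hlarge, eventually_ge_atTop R₀] with R hRM hR y hy
  have hR1 : 1 < R := hb.one_lt.trans_le hR
  have hR0 : 0 < R := by linarith
  have hdiam := hb.diam_pos hR
  have hderiv := hb.norm_deriv_le h hR (z := 1 + ((R * y : ℝ) : ℂ) * Complex.I) (by simp)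
    (by simp; linarith) (by simp [abs_mul, abs_of_pos hR0]; nlinarith)
  rw [gSpeed, div_le_iff₀ hdiam]
  calc R * ‖deriv φ (1 + ((R * y : ℝ) : ℂ) * Complex.I)‖
      ≤ R * (2 * M * (2 * diamTract φ R) * (1 / R) ^ α) := by
        gcongr
        exact hderiv.trans (by gcongr; exact hb.le_diam R hR)
    _ = R * (1 / R) ^ α * (4 * M) * diamTract φ R := by ring
    _ ≤ R * (1 / R) ^ α * R ^ (α / 2) * diamTract φ R := by gcongr
    _ = R ^ (1 - α / 2) * diamTract φ R := by
        rw [one_div, Real.inv_rpow hR0.le, ← Real.rpow_neg hR0.le,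
          show 1 - α / 2 = 1 + -α + α / 2 by ring, Real.rpow_add hR0, Real.rpow_add hR0,
          Real.rpow_one]

lemma eventually_segMean_bounds (hb : TractBounds φ M m α R₀) (h : IsTractModel Ω τ φ) :
    ∀ᶠ R in atTop, ∀ a b : ℝ, -1 ≤ a → a ≤ b → b ≤ 1 → ∀ t t' : ℝ, t ≤ t' →
      (R ^ (-(distortionConst + 1))) ^ (t' - t) * segMean φ R t a b ≤ segMean φ R t' a b ∧
      segMean φ R t' a b ≤ (R ^ (1 - α / 2)) ^ (t' - t) * segMean φ R t a b := by
  filter_upwards [hb.eventually_rpow_le_gSpeed h, hb.eventually_gSpeed_le_rpow h,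
    eventually_gt_atTop 0] with R hlow hup hR0 a b ha hab hb1 t t' htt
  have habs : ∀ y ∈ Icc a b, |y| ≤ 1 := fun y hy =>
    abs_le.2 ⟨by linarith [hy.1], by linarith [hy.2]⟩
  have hpos : ∀ y ∈ Icc a b, 0 < gSpeed φ R y := fun y hy =>
    (Real.rpow_pos_of_pos hR0 _).trans_le (hlow y (habs y hy))
  have hsp : ∀ s : ℝ, IntervalIntegrable (fun y => gSpeed φ R y ^ s) MeasureTheory.volume a b :=
    fun s => ((h.continuous_gSpeed R).continuousOn.rpow_const fun y hy =>
      Or.inl (hpos y hy).ne').intervalIntegrable_of_Icc hab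
  have hsplit : ∀ y ∈ Icc a b, gSpeed φ R y ^ t' = gSpeed φ R y ^ (t' - t) * gSpeed φ R y ^ t :=
    fun y hy => by rw [← Real.rpow_add (hpos y hy), sub_add_cancel]
  rw [h.segMean_eq hR0, h.segMean_eq hR0, ← intervalIntegral.integral_const_mul,
    ← intervalIntegral.integral_const_mul]
  constructor
  · refine intervalIntegral.integral_mono_on hab ((hsp t).const_mul _) (hsp t') fun y hy => ?_
    have := hpos y hy
    rw [hsplit y hy]
    gcongr
    exact hlow y (habs y hy)
  · refine intervalIntegral.integral_mono_on hab (hsp t') ((hsp t).const_mul _) fun y hy => ?_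
    have := hpos y hy
    rw [hsplit y hy]
    gcongr
    exact hup y (habs y hy)

lemma eventually_meanI_bounds (hb : TractBounds φ M m α R₀) (h : IsTractModel Ω τ φ) :
    ∀ᶠ R in atTop, ∀ t t' : ℝ, t ≤ t' →
      (R ^ (-(distortionConst + 1))) ^ (t' - t) * meanI φ R t ≤ meanI φ R t' ∧
      meanI φ R t' ≤ (R ^ (1 - α / 2)) ^ (t' - t) * meanI φ R t := by
  filter_upwards [hb.eventually_segMean_bounds h, eventually_gt_atTop 0] with R hR hR0 t t' htt
  have hκ := kappa_pos
  have hκ1 := kappa_lt_one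
  obtain ⟨hlow, hup⟩ := hR (-1) (-kappa) le_rfl (by linarith) (by linarith) t t' htt
  obtain ⟨hlow', hup'⟩ := hR kappa 1 (by linarith) hκ1.le le_rfl t t' htt
  unfold meanI
  rw [mul_max_of_nonneg _ _ (by positivity), mul_max_of_nonneg _ _ (by positivity)]
  exact ⟨max_le_max hlow hlow', max_le_max hup hup'⟩

lemma eventually_meanI_pos (hb : TractBounds φ M m α R₀) (h : IsTractModel Ω τ φ) :
    ∀ᶠ R in atTop, ∀ t : ℝ, 0 ≤ t → 0 < meanI φ R t := by
  filter_upwards [hb.eventually_meanI_bounds h, eventually_gt_atTop 0] with R hR hR0 t ht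
  refine lt_of_lt_of_le ?_ (hR 0 t ht).1
  have : 0 < 1 - kappa := sub_pos.2 kappa_lt_one
  rw [meanI_zero]
  positivity

lemma eventually_betaR_bounds (hb : TractBounds φ M m α R₀) (h : IsTractModel Ω τ φ) :
    ∀ᶠ R in atTop, ∀ t t' : ℝ, 0 ≤ t → t ≤ t' →
      betaR φ R t - (distortionConst + 1) * (t' - t) ≤ betaR φ R t' ∧
      betaR φ R t' ≤ betaR φ R t + (1 - α / 2) * (t' - t) := by
  filter_upwards [hb.eventually_meanI_bounds h, hb.eventually_meanI_pos h, eventually_gt_atTop 1]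
    with R hmean hpos hR1 t t' ht htt
  have hR0 : 0 < R := by linarith
  have hlog : 0 < Real.log R := Real.log_pos hR1
  obtain ⟨hlow, hup⟩ := hmean t t' htt
  have ht0 := hpos t ht
  have hloglow := Real.log_le_log (by positivity) hlow
  have hlogup := Real.log_le_log (hpos t' (ht.trans htt)) hup
  rw [Real.log_mul (by positivity) ht0.ne', Real.log_rpow (by positivity), Real.log_rpow hR0]
    at hloglow hlogup
  unfold betaR
  constructor
  · rw [le_div_iff₀ hlog, sub_mul, div_mul_cancel₀ _ hlog.ne']
    linarith
  · rw [div_le_iff₀ hlog, add_mul, div_mul_cancel₀ _ hlog.ne']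
    linarith

end TractBounds

lemma le_add_of_limsup_coe_eq {u v : ℝ → ℝ} {a b c : ℝ}
    (ha : limsup (fun R => (u R : EReal)) atTop = a)
    (hb : limsup (fun R => (v R : EReal)) atTop = b) (huv : ∀ᶠ R in atTop, u R ≤ v R + c) :
    a ≤ b + c := by
  refine le_of_forall_pos_le_add fun ε hε => ?_
  have hv : ∀ᶠ R in atTop, (v R : EReal) < ((b + ε : ℝ) : EReal) :=
    eventually_lt_of_limsup_lt (by rw [hb]; exact_mod_cast lt_add_of_pos_right b hε)
  have hu : limsup (fun R => (u R : EReal)) atTop ≤ ((b + c + ε : ℝ) : EReal) := by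
    refine limsup_le_of_le (by isBoundedDefault) ?_
    filter_upwards [hv, huv] with R hvR huvR
    have hvR' : v R < b + ε := by exact_mod_cast hvR
    exact_mod_cast (by linarith : u R ≤ b + c + ε)
  rw [ha] at hu
  exact_mod_cast hu

namespace TractBounds

variable {Ω : Set ℂ} {τ φ : ℂ → ℂ} {M m α R₀ : ℝ}

lemma coe_toReal_betaInf (hb : TractBounds φ M m α R₀) (h : IsTractModel Ω τ φ) {t : ℝ}
    (ht : 0 ≤ t) : ((betaInf φ t).toReal : EReal) = betaInf φ t := by
  have hev := (hb.eventually_betaR_bounds h).mono fun R hR => hR 0 t le_rfl ht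
  have hzero : ∀ᶠ R in atTop, |betaR φ R 0| < 1 :=
    (tendsto_betaR_zero φ).abs.eventually_lt_const (by norm_num)
  have hlow : ((-1 - (distortionConst + 1) * t : ℝ) : EReal) ≤ betaInf φ t := by
    refine le_limsup_of_frequently_le (Eventually.frequently ?_) (by isBoundedDefault)
    filter_upwards [hev, hzero] with R hR hR0
    exact_mod_cast (by linarith [hR.1, (abs_lt.1 hR0).1] :
      -1 - (distortionConst + 1) * t ≤ betaR φ R t)
  have hup : betaInf φ t ≤ ((1 + (1 - α / 2) * t : ℝ) : EReal) := by
    refine limsup_le_of_le (by isBoundedDefault) ?_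
    filter_upwards [hev, hzero] with R hR hR0
    exact_mod_cast (by linarith [hR.2, (abs_lt.1 hR0).2] : betaR φ R t ≤ 1 + (1 - α / 2) * t)
  exact EReal.coe_toReal (hup.trans_lt (EReal.coe_lt_top _)).ne
    ((EReal.bot_lt_coe _).trans_le hlow).ne'

lemma toReal_betaInf_bounds (hb : TractBounds φ M m α R₀) (h : IsTractModel Ω τ φ) {t t' : ℝ}
    (ht : 0 ≤ t) (htt : t ≤ t') :
    (betaInf φ t).toReal - (distortionConst + 1) * (t' - t) ≤ (betaInf φ t').toReal ∧
      (betaInf φ t').toReal ≤ (betaInf φ t).toReal + (1 - α / 2) * (t' - t) := by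
  have hev := (hb.eventually_betaR_bounds h).mono fun R hR => hR t t' ht htt
  have hfin := (hb.coe_toReal_betaInf h ht).symm
  have hfin' := (hb.coe_toReal_betaInf h (ht.trans htt)).symm
  refine ⟨sub_le_iff_le_add.2 (le_add_of_limsup_coe_eq hfin hfin' ?_),
    le_add_of_limsup_coe_eq hfin' hfin (hev.mono fun R hR => hR.2)⟩
  exact hev.mono fun R hR => sub_le_iff_le_add.1 hR.1

end TractBounds

lemma betaInf_zero (φ : ℂ → ℂ) : betaInf φ 0 = 0 :=
  ((continuous_coe_real_ereal.tendsto 0).comp (tendsto_betaR_zero φ)).limsup_eq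

lemma existsUnique_zero {b : ℝ → ℝ} {a A : ℝ} (ha : 0 < a) (h0 : 0 ≤ b 0)
    (hb : ∀ t t' : ℝ, 0 ≤ t → t ≤ t' → b t - A * (t' - t) ≤ b t' ∧ b t' ≤ b t - a * (t' - t)) :
    ∃! Θ, 0 ≤ Θ ∧ b Θ = 0 := by
  have hanti : StrictAntiOn b (Ici 0) := fun t ht t' _ htt => by
    nlinarith [(hb t t' ht htt.le).2, mul_pos ha (sub_pos.2 htt)]
  have hcont : ContinuousOn b (Ici 0) := by
    refine (LipschitzOnWith.of_le_add_mul A.toNNReal fun x hx y hy => ?_).continuousOn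
    have hA := le_max_left A 0
    rw [Real.coe_toNNReal', Real.dist_eq]
    rcases le_total x y with hxy | hxy
    · have := mul_le_mul_of_nonneg_right hA (sub_nonneg.2 hxy)
      rw [abs_sub_comm, abs_of_nonneg (sub_nonneg.2 hxy)]
      linarith [(hb x y hx hxy).1]
    · have := mul_nonneg (le_max_right A 0) (abs_nonneg (x - y))
      linarith [hanti.antitoneOn hy hx hxy]
  have hT : 0 ≤ b 0 / a := by positivity
  have hbT : b (b 0 / a) ≤ 0 := by
    simpa [mul_div_cancel₀ _ ha.ne'] using (hb 0 (b 0 / a) le_rfl hT).2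
  obtain ⟨Θ, hΘ, hz⟩ := intermediate_value_Icc' hT (hcont.mono Icc_subset_Ici_self) ⟨hbT, h0⟩
  exact ⟨Θ, ⟨hΘ.1, hz⟩, fun t ht => hanti.injOn ht.1 hΘ.1 (ht.2.trans hz.symm)⟩

/-! ### The spectrum at `t = 1` -/

lemma exists_frequently_le_of_le_mul_exp {v : ℝ → ℝ} {q B ε R₁ : ℝ} (hq : 0 < q) (hq1 : q < 1)
    (hB : 0 ≤ B) (hε : 0 < ε) (hR₁ : 0 < R₁) (hv : ∀ R, 0 ≤ v R)
    (hstep : ∀ R, R₁ ≤ R → v R ≤ v (q * R) * Real.exp (B * R ^ (-ε))) :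
    ∃ A, ∃ᶠ R in atTop, v R ≤ A := by
  -- `c` is chosen so that `w R ≤ w (q R)`.
  set c := B / (q ^ (-ε) - 1) with hc
  set w : ℝ → ℝ := fun R => v R * Real.exp (c * R ^ (-ε)) with hw
  have hqε : 0 < q ^ (-ε) - 1 :=
    sub_pos.2 (Real.one_lt_rpow_of_pos_of_lt_one_of_neg hq hq1 (neg_neg_iff_pos.2 hε))
  have hcB : B + c = c * q ^ (-ε) := by
    rw [hc]
    field_simp
    ring
  have hwstep : ∀ R, R₁ ≤ R → w R ≤ w (q * R) := fun R hR => by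
    calc w R ≤ v (q * R) * Real.exp (B * R ^ (-ε)) * Real.exp (c * R ^ (-ε)) := by
          simp only [hw]
          gcongr
          exact hstep R hR
      _ = w (q * R) := by
          simp only [hw]
          rw [mul_assoc, ← Real.exp_add, ← add_mul, hcB,
            Real.mul_rpow hq.le (hR₁.trans_le hR).le, mul_assoc]
  have hbound : ∀ n : ℕ, w (R₁ / q ^ n) ≤ w R₁ := by
    intro n
    induction n with
    | zero => simp
    | succ n ih =>
      refine (hwstep _ (le_div_self hR₁.le (by positivity) (pow_le_one₀ hq.le hq1.le))).trans ?_
      rwa [pow_succ, ← div_div, mul_div_cancel₀ _ hq.ne']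
  have htendsto : Tendsto (fun n : ℕ => R₁ / q ^ n) atTop atTop := by
    simpa only [inv_pow, div_eq_mul_inv] using
      (tendsto_pow_atTop_atTop_of_one_lt ((one_lt_inv₀ hq).2 hq1)).const_mul_atTop hR₁
  refine ⟨w R₁, htendsto.frequently (Frequently.of_forall fun n => ?_)⟩
  refine (le_mul_of_one_le_right (hv _) (Real.one_le_exp ?_)).trans (hbound n)
  positivity

lemma le_mul_exp_of_sub_le {a b y : ℝ} (ha : 0 ≤ a) (hb : 0 ≤ b) (hy : 0 ≤ y) (hy2 : y ≤ 1 / 2)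
    (h : a - b ≤ y * a) : a ≤ b * Real.exp (2 * y) :=
  calc a ≤ a * ((1 - y) * (1 + 2 * y)) := le_mul_of_one_le_right ha (by nlinarith)
    _ ≤ b * (1 + 2 * y) := by
        rw [← mul_assoc]
        gcongr
        linarith
    _ ≤ b * Real.exp (2 * y) := by
        gcongr
        linarith [Real.add_one_le_exp (2 * y)]

lemma eventually_meanI_lt_rpow {φ : ℂ → ℂ} {t c : ℝ} (h : betaInf φ t < c) :
    ∀ᶠ R in atTop, meanI φ R t < R ^ c := by
  have hlt : ∀ᶠ R in atTop, (betaR φ R t : EReal) < c := eventually_lt_of_limsup_lt h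
  filter_upwards [hlt, eventually_gt_atTop 1] with R hR hR1
  have hR0 : 0 < R := by linarith
  have hR' : betaR φ R t < c := by exact_mod_cast hR
  rw [betaR, div_lt_iff₀ (Real.log_pos hR1), ← Real.log_rpow hR0] at hR'
  contrapose! hR'
  exact Real.log_le_log (by positivity) hR'

lemma IsTractModel.tendsto_norm_one_add {Ω : Set ℂ} {τ φ : ℂ → ℂ} (h : IsTractModel Ω τ φ) :
    Tendsto (fun R : ℝ => ‖φ (1 + (R : ℂ) * Complex.I)‖) atTop atTop := by
  refine h.tendsto_norm_comp (tendsto_atTop_mono (fun R => ?_) tendsto_id)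
    (Eventually.of_forall one_add_mul_I_mem_rightHalfPlane)
  simpa using (le_abs_self _).trans (Complex.abs_im_le_norm (1 + (R : ℂ) * Complex.I))

namespace TractBounds

variable {Ω : Set ℂ} {τ φ : ℂ → ℂ} {M m α R₀ R : ℝ}

lemma norm_sub_le_segMean (hb : TractBounds φ M m α R₀) (h : IsTractModel Ω τ φ)
    (hR : R₀ ≤ R) {a b : ℝ} (hab : a ≤ b) :
    ‖φ (1 + ((R * b : ℝ) : ℂ) * Complex.I) - φ (1 + ((R * a : ℝ) : ℂ) * Complex.I)‖ ≤
      diamTract φ R * segMean φ R 1 a b := by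
  have hR0 : 0 < R := by linarith [hb.one_lt]
  have hdiam := hb.diam_pos hR
  have hderiv : ∀ y : ℝ, HasDerivAt (fun y : ℝ => φ (1 + ((R * y : ℝ) : ℂ) * Complex.I))
      (deriv φ (1 + ((R * y : ℝ) : ℂ) * Complex.I) * ((R : ℂ) * Complex.I)) y := by
    intro y
    have hmul : HasDerivAt (fun y : ℝ => R * y) R y := hasDerivAt_const_mul R
    exact (h.hasDerivAt (one_add_mul_I_mem_rightHalfPlane _)).comp y
      ((hmul.ofReal_comp.mul_const Complex.I).const_add 1)
  have hcont : Continuous fun y : ℝ =>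
      deriv φ (1 + ((R * y : ℝ) : ℂ) * Complex.I) * ((R : ℂ) * Complex.I) :=
    (h.differentiableOn_deriv.continuousOn.comp_continuous (by fun_prop)
      fun y => one_add_mul_I_mem_rightHalfPlane _).mul continuous_const
  rw [← intervalIntegral.integral_eq_sub_of_hasDerivAt (fun y _ => hderiv y)
    (hcont.intervalIntegrable _ _), h.segMean_eq hR0, ← intervalIntegral.integral_const_mul]
  refine (intervalIntegral.norm_integral_le_integral_norm hab).trans_eq ?_
  refine intervalIntegral.integral_congr fun y _ => ?_
  simp only [Real.rpow_one, gSpeed, norm_mul, Complex.norm_I, mul_one,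
    Complex.norm_of_nonneg hR0.le]
  field_simp

lemma norm_one_add_le_mul_exp (hb : TractBounds φ M m α R₀) (h : IsTractModel Ω τ φ)
    (hR : R₀ ≤ R) {S : ℝ} (hS : segMean φ R 1 kappa 1 ≤ S) (hS0 : 0 ≤ S)
    (hSm : M / m * S ≤ 1 / 2) :
    ‖φ (1 + (R : ℂ) * Complex.I)‖ ≤
      ‖φ (1 + ((kappa * R : ℝ) : ℂ) * Complex.I)‖ * Real.exp (2 * (M / m * S)) := by
  have hR1 : 1 < R := hb.one_lt.trans_le hR
  have hM := hb.one_le_M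
  have hm := hb.m_pos
  have hs := hb.scale_pos R hR
  have hsub := hb.norm_sub_le_segMean h hR kappa_lt_one.le
  rw [mul_one, mul_comm R kappa] at hsub
  have hlow : m * tractScale φ R ≤ ‖φ (1 + (R : ℂ) * Complex.I)‖ := by
    refine hb.le_norm R hR _ ⟨?_, ?_, ?_, ?_⟩ ?_ <;>
      simp [abs_of_pos (one_pos.trans hR1)] <;> nlinarith [kappa_lt_one]
  refine le_mul_exp_of_sub_le (norm_nonneg _) (norm_nonneg _) (by positivity) hSm ?_
  calc ‖φ (1 + (R : ℂ) * Complex.I)‖ - ‖φ (1 + ((kappa * R : ℝ) : ℂ) * Complex.I)‖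
      ≤ diamTract φ R * segMean φ R 1 kappa 1 := (norm_sub_norm_le _ _).trans hsub
    _ ≤ M * tractScale φ R * S :=
        (mul_le_mul_of_nonneg_left hS (hb.diam_pos hR).le).trans
          (mul_le_mul_of_nonneg_right (hb.diam_le R hR) hS0)
    _ = M / m * S * (m * tractScale φ R) := by field_simp
    _ ≤ M / m * S * ‖φ (1 + (R : ℂ) * Complex.I)‖ := by gcongr

lemma betaInf_one_nonneg (hb : TractBounds φ M m α R₀) (h : IsTractModel Ω τ φ) :
    0 ≤ betaInf φ 1 := by
  by_contra! hneg
  obtain ⟨c, hc, hc0⟩ := EReal.lt_iff_exists_real_btwn.1 hneg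
  obtain ⟨ε, rfl⟩ : ∃ ε, c = -ε := ⟨-c, (neg_neg c).symm⟩
  have hε : 0 < ε := by simpa using hc0
  have hM := hb.one_le_M
  have hm := hb.m_pos
  have hsmall : ∀ᶠ R : ℝ in atTop, M / m * R ^ (-ε) < 1 / 2 := by
    have hlim := (tendsto_rpow_neg_atTop hε).const_mul (M / m)
    rw [mul_zero] at hlim
    exact hlim.eventually_lt_const (by norm_num)
  obtain ⟨R₁, hR₁⟩ := eventually_atTop.1
    ((eventually_meanI_lt_rpow hc).and (hsmall.and (eventually_ge_atTop R₀)))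
  have hstep : ∀ R, max R₁ 1 ≤ R → ‖φ (1 + (R : ℂ) * Complex.I)‖ ≤
      ‖φ (1 + ((kappa * R : ℝ) : ℂ) * Complex.I)‖ * Real.exp (2 * (M / m) * R ^ (-ε)) := by
    intro R hR
    obtain ⟨hmean, hRsmall, hRR₀⟩ := hR₁ R ((le_max_left _ _).trans hR)
    have hR0 : 0 < R := one_pos.trans_le ((le_max_right _ _).trans hR)
    rw [mul_assoc]
    exact hb.norm_one_add_le_mul_exp h hRR₀ ((le_max_right _ _).trans hmean.le)
      (by positivity) hRsmall.le
  obtain ⟨A, hA⟩ := exists_frequently_le_of_le_mul_exp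
    (v := fun R => ‖φ (1 + (R : ℂ) * Complex.I)‖) kappa_pos kappa_lt_one (by positivity) hε
    (by positivity : 0 < max R₁ 1) (fun _ => norm_nonneg _) hstep
  obtain ⟨R, hR, hR'⟩ := (hA.and_eventually (h.tendsto_norm_one_add.eventually_gt_atTop A)).exists
  exact hR.not_gt hR'

end TractBounds

/-! ### Inverse branches of a tract -/

section

open Metric

/-- The branch of `log (w / lam)` on a disk around `C` with imaginary part near `2πk`. -/
noncomputable def logBranch (lam : ℝ) (C : ℂ) (k : ℤ) (w : ℂ) : ℂ :=
  Complex.log (C / lam) + Complex.log (w / C) + k * (2 * Real.pi * Complex.I)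

variable {lam B : ℝ} {C w x y : ℂ} {k : ℤ}

lemma div_mem_slitPlane (hw : ‖w - C‖ < ‖C‖) : w / C ∈ Complex.slitPlane := by
  have hC : 0 < ‖C‖ := (norm_nonneg _).trans_lt hw
  rw [← add_sub_cancel 1 (w / C)]
  refine Complex.mem_slitPlane_of_norm_lt_one ?_
  rwa [div_sub_one (norm_pos_iff.1 hC), norm_div, div_lt_one hC]

lemma mul_exp_logBranch (hl : 0 < lam) (hC : C ≠ 0) (hw : w ≠ 0) :
    (lam : ℂ) * Complex.exp (logBranch lam C k w) = w := by
  have hlam : (lam : ℂ) ≠ 0 := Complex.ofReal_ne_zero.2 hl.ne'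
  rw [logBranch, Complex.exp_periodic.int_mul k, Complex.exp_add,
    Complex.exp_log (div_ne_zero hC hlam), Complex.exp_log (div_ne_zero hw hC)]
  field_simp

lemma hasDerivAt_logBranch (hw : ‖w - C‖ < ‖C‖) :
    HasDerivAt (logBranch lam C k) (1 / w) w := by
  have hslit := div_mem_slitPlane hw
  obtain ⟨hw0, hC0⟩ := div_ne_zero_iff.1 (Complex.slitPlane_ne_zero hslit)
  have hlog := (((hasDerivAt_id w).div_const C).clog hslit).const_add (Complex.log (C / lam))
  refine (hlog.add_const _).congr_deriv ?_
  simp only [id]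
  field_simp

lemma logBranch_re (hl : 0 < lam) (hC : C ≠ 0) (hw : w ≠ 0) :
    (logBranch lam C k w).re = Real.log ‖w‖ - Real.log lam := by
  have hnorm := congrArg (Real.log ‖·‖) (mul_exp_logBranch (k := k) hl hC hw)
  simp only [norm_mul, Complex.norm_exp, Complex.norm_of_nonneg hl.le] at hnorm
  rw [Real.log_mul hl.ne' (Real.exp_ne_zero _), Real.log_exp] at hnorm
  linarith

lemma abs_logBranch_im_sub_le (lam : ℝ) (C : ℂ) (k : ℤ) (w : ℂ) :
    |(logBranch lam C k w).im - 2 * Real.pi * k| ≤ 2 * Real.pi := by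
  have him : (logBranch lam C k w).im - 2 * Real.pi * k =
      Complex.arg (C / lam) + Complex.arg (w / C) := by
    simp [logBranch, Complex.log_im]
    ring
  rw [him]
  linarith [abs_add_le (Complex.arg (C / lam)) (Complex.arg (w / C)),
    Complex.abs_arg_le_pi (C / lam), Complex.abs_arg_le_pi (w / C)]

lemma norm_exp_sub_exp_le {a b : ℂ} (ha : a.re ≤ B) (hb : b.re ≤ B) :
    ‖Complex.exp a - Complex.exp b‖ ≤ Real.exp B * ‖a - b‖ := by
  refine (convex_halfSpace_re_le B).norm_image_sub_le_of_norm_hasDerivWithin_le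
    (fun z _ => (Complex.hasDerivAt_exp z).hasDerivWithinAt) (fun z hz => ?_) hb ha
  rw [Complex.norm_exp]
  exact Real.exp_le_exp.2 hz

lemma norm_sub_le_mul_norm_logBranch_sub (hl : 0 < lam) (hC : C ≠ 0) (hx : x ≠ 0) (hy : y ≠ 0)
    (hxB : ‖x‖ ≤ B) (hyB : ‖y‖ ≤ B) :
    ‖x - y‖ ≤ B * ‖logBranch lam C k x - logBranch lam C k y‖ := by
  have hB : 0 < B := (norm_pos_iff.2 hx).trans_le hxB
  have hre : ∀ w ≠ 0, ‖w‖ ≤ B → (logBranch lam C k w).re ≤ Real.log B - Real.log lam := by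
    intro w hw hwB
    rw [logBranch_re hl hC hw]
    gcongr
  have hexp := norm_exp_sub_exp_le (hre x hx hxB) (hre y hy hyB)
  rw [Real.exp_sub, Real.exp_log hB, Real.exp_log hl] at hexp
  calc ‖x - y‖ = lam * ‖Complex.exp (logBranch lam C k x) - Complex.exp (logBranch lam C k y)‖ := by
        conv_lhs =>
          rw [← mul_exp_logBranch (k := k) hl hC hx, ← mul_exp_logBranch (k := k) hl hC hy]
        rw [← mul_sub, norm_mul, Complex.norm_of_nonneg hl.le]
    _ ≤ lam * (B / lam * ‖logBranch lam C k x - logBranch lam C k y‖) := by gcongr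
    _ = B * ‖logBranch lam C k x - logBranch lam C k y‖ := by field_simp

lemma IsTractModel.norm_deriv_le_of_norm_sub_le {Ω : Set ℂ} {τ φ : ℂ → ℂ} {z : ℂ}
    (h : IsTractModel Ω τ φ) (hw : 0 < w.re) (hzw : ‖z - w‖ ≤ w.re / 4) :
    ‖deriv φ w‖ ≤ ‖deriv φ z‖ * Real.exp (distortionConst * 2) := by
  have hre := abs_le.1 ((Complex.abs_re_le_norm (z - w)).trans hzw)
  rw [Complex.sub_re] at hre
  have hz : 0 < z.re := by linarith
  have hlog : |Real.log (w.re / z.re)| ≤ 1 := by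
    rw [abs_le, Real.le_log_iff_exp_le (by positivity), Real.log_le_iff_le_exp (by positivity),
      le_div_iff₀ hz, div_le_iff₀ hz]
    have hexp := Real.add_one_le_exp (1 : ℝ)
    have hexp_neg : Real.exp (-1) ≤ 1 / 2 := by
      rw [Real.exp_neg, one_div]
      exact inv_anti₀ two_pos (by linarith)
    constructor <;> nlinarith
  have him : |w.im - z.im| / w.re ≤ 1 := by
    rw [div_le_one hw, abs_sub_comm, ← Complex.sub_im]
    linarith [Complex.abs_im_le_norm (z - w)]
  refine (h.norm_deriv_le_mul_exp hz hw).trans ?_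
  have := distortionConst_pos
  gcongr
  linarith

/-- The point with real part `log P` and imaginary part `2πk`. For `P` comparable to `|C|`, all
values of `logBranch lam C k` lie at bounded distance of it. -/
noncomputable def gridPoint (P : ℝ) (k : ℤ) : ℂ := ⟨Real.log P, 2 * Real.pi * k⟩

/-- The derivative of `φ` at the `k`-th grid point at scale `R`, relative to the scale: up to a
constant factor, the contraction ratio of the `k`-th inverse branch of `lam * exp τ`. -/
noncomputable def gridWeight (φ : ℂ → ℂ) (R : ℝ) (k : ℤ) : ℝ :=
  ‖deriv φ (gridPoint (tractScale φ R) k)‖ / tractScale φ R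

/-- A bound for the distance between `gridPoint P k` and the values of `logBranch lam C k` at
points of modulus between `mP / 2` and `2MP`. -/
noncomputable def gridError (M m lam : ℝ) : ℝ :=
  |Real.log (m / 2)| + |Real.log (2 * M)| + |Real.log lam| + 2 * Real.pi

lemma six_le_gridError (M m lam : ℝ) : 6 ≤ gridError M m lam := by
  have h : 0 ≤ |Real.log (m / 2)| + |Real.log (2 * M)| + |Real.log lam| := by positivity
  unfold gridError
  linarith [Real.pi_gt_three]

lemma norm_logBranch_sub_gridPoint_le {M m P : ℝ} (hl : 0 < lam) (hm : 0 < m) (hP : 0 < P)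
    (hC : C ≠ 0) (hw : m / 2 * P ≤ ‖w‖) (hw' : ‖w‖ ≤ 2 * M * P) :
    ‖logBranch lam C k w - gridPoint P k‖ ≤ gridError M m lam := by
  have hw0 : 0 < ‖w‖ := lt_of_lt_of_le (by positivity) hw
  have hM : 0 < 2 * M := pos_of_mul_pos_left (hw0.trans_le hw') hP.le
  have hlow := Real.log_le_log (by positivity) hw
  have hupp := Real.log_le_log hw0 hw'
  rw [Real.log_mul (by positivity) hP.ne'] at hlow hupp
  have hre : |(logBranch lam C k w - gridPoint P k).re| ≤
      |Real.log (m / 2)| + |Real.log (2 * M)| + |Real.log lam| := by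
    rw [Complex.sub_re, logBranch_re hl hC (norm_pos_iff.1 hw0)]
    simp only [gridPoint]
    rw [abs_le]
    constructor <;> linarith [neg_abs_le (Real.log (m / 2)), le_abs_self (Real.log (2 * M)),
      neg_abs_le (Real.log lam), le_abs_self (Real.log lam), abs_nonneg (Real.log (m / 2)),
      abs_nonneg (Real.log (2 * M))]
  exact (Complex.norm_le_abs_re_add_abs_im _).trans
    (add_le_add hre (abs_logBranch_im_sub_le lam C k w))

/-- The scale `R` is so large that `gridError` is negligible at scale `R`. -/
structure IsLargeScale (φ : ℂ → ℂ) (M m α R₀ lam R : ℝ) : Prop where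
  le : R₀ ≤ R
  gridError_le : 4 * gridError M m lam ≤ Real.log (tractScale φ R)
  log_le : Real.log (tractScale φ R) ≤ R / 2
  rpow_le : M * (gridError M m lam / R) ^ α ≤ m / 16

/-- A set of indices `k` for which `φ` maps the grid points at scale `R` near a common point `C`
of modulus comparable to the scale. The inverse branches of `lam * exp τ` with these indices map a
disk around `C` into itself. -/
structure IsGridCluster (φ : ℂ → ℂ) (M m R : ℝ) (S : Finset ℤ) (C : ℂ) : Prop where
  nonempty : S.Nonempty
  le_norm : m * tractScale φ R ≤ ‖C‖
  norm_le : ‖C‖ ≤ M * tractScale φ R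
  abs_le : ∀ k ∈ S, |2 * Real.pi * k| ≤ R + Real.pi
  norm_sub_le : ∀ k ∈ S, ‖φ (gridPoint (tractScale φ R) k) - C‖ ≤ m * tractScale φ R / 8

lemma TractBounds.eventually_log_tractScale_le {φ : ℂ → ℂ} {M m α R₀ : ℝ}
    (hb : TractBounds φ M m α R₀) :
    ∀ᶠ R in atTop, Real.log (tractScale φ R) ≤ (distortionConst + 2) * Real.log R := by
  filter_upwards [eventually_ge_atTop R₀] with R hR
  rw [← Real.log_rpow (by linarith [hb.one_lt])]
  exact Real.log_le_log (hb.scale_pos R hR) (hb.scale_le R hR)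

lemma TractBounds.eventually_isLargeScale {φ : ℂ → ℂ} {M m α R₀ : ℝ}
    (hb : TractBounds φ M m α R₀) (lam : ℝ) :
    ∀ᶠ R in atTop, IsLargeScale φ M m α R₀ lam R := by
  have hdist := distortionConst_pos
  have hlog : ∀ᶠ R : ℝ in atTop, (distortionConst + 2) * Real.log R ≤ R / 2 := by
    filter_upwards [Real.isLittleO_log_id_atTop.bound
      (c := (2 * (distortionConst + 2))⁻¹) (by positivity), eventually_ge_atTop 0] with R hR hR0
    rw [Real.norm_eq_abs, id, Real.norm_of_nonneg hR0, inv_mul_eq_div, le_div_iff₀' (by positivity)]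
      at hR
    nlinarith [le_abs_self (Real.log R)]
  have hrpow : Tendsto (fun R : ℝ => M * (gridError M m lam / R) ^ α) atTop (𝓝 0) := by
    simpa [Real.zero_rpow hb.alpha_pos.ne'] using
      ((tendsto_const_nhds.div_atTop tendsto_id).rpow_const (Or.inr hb.alpha_pos.le)).const_mul M
  filter_upwards [eventually_ge_atTop R₀, hlog, hb.eventually_log_tractScale_le,
    (Real.tendsto_log_atTop.comp hb.tendsto).eventually_ge_atTop (4 * gridError M m lam),
    hrpow.eventually_le_const (div_pos hb.m_pos (by norm_num : (0 : ℝ) < 16))]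
    with R hR hR' hscale hgrid hrpow
  exact ⟨hR, hgrid, hscale.trans hR', hrpow⟩

namespace IsLargeScale

variable {φ : ℂ → ℂ} {M m α R₀ R : ℝ} {z : ℂ}

lemma le_log (hR : IsLargeScale φ M m α R₀ lam R) : 24 ≤ Real.log (tractScale φ R) := by
  linarith [hR.gridError_le, six_le_gridError M m lam]

lemma le_scale (hR : IsLargeScale φ M m α R₀ lam R) : 48 ≤ R := by
  linarith [hR.log_le, hR.le_log]

lemma gridPoint_re_pos (hR : IsLargeScale φ M m α R₀ lam R) (k : ℤ) :
    0 < (gridPoint (tractScale φ R) k).re :=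
  (by norm_num : (0 : ℝ) < 24).trans_le hR.le_log

lemma bounds_of_norm_sub_gridPoint_le (hR : IsLargeScale φ M m α R₀ lam R)
    (hk : |2 * Real.pi * k| ≤ R + Real.pi)
    (hz : ‖z - gridPoint (tractScale φ R) k‖ ≤ gridError M m lam) :
    1 ≤ z.re ∧ z.re ≤ R ∧ |z.im| ≤ 3 / 2 * R := by
  have hre := abs_le.1 ((Complex.abs_re_le_norm _).trans hz)
  have him := (Complex.abs_im_le_norm _).trans hz
  simp only [gridPoint, Complex.sub_re, Complex.sub_im] at hre him
  have hlog := hR.le_log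
  have hgrid := hR.gridError_le
  have hlog_le := hR.log_le
  refine ⟨by linarith, by linarith, ?_⟩
  linarith [abs_sub_abs_le_abs_sub z.im (2 * Real.pi * k), Real.pi_le_four]

lemma mem_Q_of_norm_sub_gridPoint_le (hR : IsLargeScale φ M m α R₀ lam R)
    (hk : |2 * Real.pi * k| ≤ R + Real.pi)
    (hz : ‖z - gridPoint (tractScale φ R) k‖ ≤ gridError M m lam) : z ∈ Q (2 * R) := by
  obtain ⟨hre, hreR, him⟩ := hR.bounds_of_norm_sub_gridPoint_le hk hz
  obtain ⟨him₁, him₂⟩ := abs_le.1 him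
  exact ⟨by linarith, by linarith [hR.le_scale], by linarith [hR.le_scale],
    by linarith [hR.le_scale]⟩

lemma gridPoint_mem_Q (hR : IsLargeScale φ M m α R₀ lam R)
    (hk : |2 * Real.pi * k| ≤ R + Real.pi) : gridPoint (tractScale φ R) k ∈ Q (2 * R) :=
  hR.mem_Q_of_norm_sub_gridPoint_le hk <| by
    rw [sub_self, norm_zero]
    linarith [six_le_gridError M m lam]

end IsLargeScale

namespace IsGridCluster

variable {φ : ℂ → ℂ} {M m R : ℝ} {S : Finset ℤ}

lemma norm_sub_lt (hS : IsGridCluster φ M m R S C) (hw : w ∈ ball C (m * tractScale φ R / 4)) :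
    ‖w - C‖ < ‖C‖ := by
  rw [mem_ball_iff_norm] at hw
  linarith [norm_nonneg (w - C), hS.le_norm]

lemma ne_zero (hS : IsGridCluster φ M m R S C) (hw : w ∈ ball C (m * tractScale φ R / 4)) :
    w ≠ 0 := by
  rintro rfl
  simpa using hS.norm_sub_lt hw

lemma center_ne_zero (hS : IsGridCluster φ M m R S C)
    (hw : w ∈ ball C (m * tractScale φ R / 4)) : C ≠ 0 :=
  norm_pos_iff.1 ((norm_nonneg _).trans_lt (hS.norm_sub_lt hw))

lemma half_mul_le_norm (hS : IsGridCluster φ M m R S C)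
    (hw : w ∈ ball C (m * tractScale φ R / 4)) : m / 2 * tractScale φ R ≤ ‖w‖ := by
  rw [mem_ball_iff_norm'] at hw
  linarith [norm_sub_norm_le C w, hS.le_norm, norm_nonneg (C - w)]

lemma norm_le_two_mul (hS : IsGridCluster φ M m R S C)
    (hw : w ∈ ball C (m * tractScale φ R / 4)) : ‖w‖ ≤ 2 * M * tractScale φ R := by
  linarith [hS.norm_sub_lt hw, norm_sub_norm_le w C, hS.norm_le]

end IsGridCluster

namespace TractBounds

variable {Ω : Set ℂ} {τ φ f : ℂ → ℂ} {M m α R₀ R : ℝ} {S : Finset ℤ}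

lemma norm_logBranch_sub_gridPoint_le (hb : TractBounds φ M m α R₀) (hl : 0 < lam)
    (hR : R₀ ≤ R) (hS : IsGridCluster φ M m R S C) (hw : w ∈ ball C (m * tractScale φ R / 4)) :
    ‖logBranch lam C k w - gridPoint (tractScale φ R) k‖ ≤ gridError M m lam :=
  HolderTract.norm_logBranch_sub_gridPoint_le hl hb.m_pos (hb.scale_pos R hR)
    (hS.center_ne_zero hw) (hS.half_mul_le_norm hw) (hS.norm_le_two_mul hw)

lemma logBranch_re_pos (hb : TractBounds φ M m α R₀) (hl : 0 < lam)
    (hR : IsLargeScale φ M m α R₀ lam R) (hS : IsGridCluster φ M m R S C)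
    (hw : w ∈ ball C (m * tractScale φ R / 4)) : 0 < (logBranch lam C k w).re := by
  have hre := abs_le.1 ((Complex.abs_re_le_norm _).trans
    (hb.norm_logBranch_sub_gridPoint_le (k := k) hl hR.le hS hw))
  simp only [gridPoint, Complex.sub_re] at hre
  linarith [hR.gridError_le, hR.le_log]

lemma hasDerivAt_comp_logBranch (hb : TractBounds φ M m α R₀) (h : IsTractModel Ω τ φ)
    (hl : 0 < lam) (hR : IsLargeScale φ M m α R₀ lam R) (hS : IsGridCluster φ M m R S C)
    (hw : w ∈ ball C (m * tractScale φ R / 4)) :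
    HasDerivAt (φ ∘ logBranch lam C k) (deriv φ (logBranch lam C k w) * (1 / w)) w :=
  (h.hasDerivAt (hb.logBranch_re_pos hl hR hS hw)).comp w
    (hasDerivAt_logBranch (hS.norm_sub_lt hw))

lemma comp_logBranch_mem_closedBall (hb : TractBounds φ M m α R₀) (hl : 0 < lam)
    (hR : IsLargeScale φ M m α R₀ lam R) (hS : IsGridCluster φ M m R S C) (hk : k ∈ S)
    (hw : w ∈ ball C (m * tractScale φ R / 4)) :
    φ (logBranch lam C k w) ∈ closedBall C (3 / 16 * m * tractScale φ R) := by
  have hP := hb.scale_pos R hR.le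
  have hM := hb.one_le_M
  have hα := hb.alpha_pos
  have hR0 : 0 < R := by linarith [hR.le_scale]
  have hgrid := hb.norm_logBranch_sub_gridPoint_le (k := k) hl hR.le hS hw
  have hφ : ‖φ (logBranch lam C k w) - φ (gridPoint (tractScale φ R) k)‖ ≤
      m / 16 * tractScale φ R :=
    calc _ ≤ M * tractScale φ R *
          (‖logBranch lam C k w - gridPoint (tractScale φ R) k‖ / R) ^ α :=
          hb.holder R hR.le _ (hR.mem_Q_of_norm_sub_gridPoint_le (hS.abs_le k hk) hgrid) _
            (hR.gridPoint_mem_Q (hS.abs_le k hk))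
      _ ≤ M * tractScale φ R * (gridError M m lam / R) ^ α := by gcongr
      _ = M * (gridError M m lam / R) ^ α * tractScale φ R := by ring
      _ ≤ m / 16 * tractScale φ R := by
          gcongr
          exact hR.rpow_le
  rw [mem_closedBall_iff_norm]
  linarith [norm_sub_le_norm_sub_add_norm_sub (φ (logBranch lam C k w))
    (φ (gridPoint (tractScale φ R) k)) C, hS.norm_sub_le k hk]

lemma norm_deriv_comp_logBranch_le (hb : TractBounds φ M m α R₀) (h : IsTractModel Ω τ φ)
    (hl : 0 < lam) (hR : IsLargeScale φ M m α R₀ lam R) (hS : IsGridCluster φ M m R S C)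
    (hk : k ∈ S) (hw : w ∈ ball C (m * tractScale φ R / 4)) :
    ‖deriv (φ ∘ logBranch lam C k) w‖ ≤ 1 / 2 := by
  have hP := hb.scale_pos R hR.le
  have hM := hb.one_le_M
  have hα := hb.alpha_pos
  have hm := hb.m_pos
  have hR0 : 0 < R := by linarith [hR.le_scale]
  obtain ⟨hre, hreR, him⟩ := hR.bounds_of_norm_sub_gridPoint_le (hS.abs_le k hk)
    (hb.norm_logBranch_sub_gridPoint_le hl hR.le hS hw)
  rw [(hb.hasDerivAt_comp_logBranch h hl hR hS hw).deriv, norm_mul, norm_div, norm_one,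
    mul_one_div, div_le_iff₀ (norm_pos_iff.2 (hS.ne_zero hw))]
  calc ‖deriv φ (logBranch lam C k w)‖
      ≤ 2 * M * tractScale φ R * (1 / R) ^ α :=
        hb.norm_deriv_le h hR.le hre (by linarith) him
    _ ≤ 2 * M * tractScale φ R * (gridError M m lam / R) ^ α := by
        gcongr
        linarith [six_le_gridError M m lam]
    _ = 2 * (M * (gridError M m lam / R) ^ α) * tractScale φ R := by ring
    _ ≤ 2 * (m / 16) * tractScale φ R := by
        gcongr
        exact hR.rpow_le
    _ ≤ 1 / 2 * ‖w‖ := by nlinarith [hS.half_mul_le_norm hw]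

lemma isBranchSystem (hb : TractBounds φ M m α R₀) (h : IsTractModel Ω τ φ) (hl : 0 < lam)
    (hf : ∀ z ∈ Ω, f z = lam * Complex.exp (τ z)) (hR : IsLargeScale φ M m α R₀ lam R)
    (hS : IsGridCluster φ M m R S C) :
    IsBranchSystem f Ω S (fun k => φ ∘ logBranch lam C k) C (m * tractScale φ R / 4)
      (3 / 16 * m * tractScale φ R) := by
  have hP := hb.scale_pos R hR.le
  have hmP := mul_pos hb.m_pos hP
  have hmem : ∀ k, ∀ w ∈ ball C (m * tractScale φ R / 4), logBranch lam C k w ∈ rightHalfPlane :=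
    fun k w hw => hb.logBranch_re_pos hl hR hS hw
  exact
  { pos := by positivity
    lt := by linarith
    isOpen := h.isOpen
    holo := (h.holo.cexp.const_mul _).congr hf
    nonempty := hS.nonempty
    mapsTo := fun k hk w hw => hb.comp_logBranch_mem_closedBall hl hR hS hk hw
    mapsTo_dom := fun k _ w hw => h.mapsTo_inv (hmem k w hw)
    holo_branch := fun k _ w hw =>
      (hb.hasDerivAt_comp_logBranch h hl hR hS hw).differentiableAt.differentiableWithinAt
    inv := fun k _ w hw => by
      rw [Function.comp_apply, hf _ (h.mapsTo_inv (hmem k w hw)), h.right_inv _ (hmem k w hw),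
        mul_exp_logBranch hl (hS.center_ne_zero hw) (hS.ne_zero hw)]
    ne := fun j _ k _ hjk w hw heq => by
      have hlog := h.injOn (hmem j w hw) (hmem k w hw) heq
      rw [logBranch, logBranch, add_right_inj,
        mul_left_inj' Complex.two_pi_I_ne_zero] at hlog
      exact hjk (by exact_mod_cast hlog)
    contr := fun k hk w hw => hb.norm_deriv_comp_logBranch_le h hl hR hS hk hw }

lemma mul_norm_sub_le_norm_comp_logBranch_sub (hb : TractBounds φ M m α R₀)
    (h : IsTractModel Ω τ φ) (hl : 0 < lam) (hR : IsLargeScale φ M m α R₀ lam R)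
    (hS : IsGridCluster φ M m R S C) (hx : x ∈ ball C (m * tractScale φ R / 4))
    (hy : y ∈ ball C (m * tractScale φ R / 4)) :
    (512 * Real.exp (distortionConst * 2) * (2 * M))⁻¹ * gridWeight φ R k * ‖x - y‖ ≤
      ‖φ (logBranch lam C k x) - φ (logBranch lam C k y)‖ := by
  have hP := hb.scale_pos R hR.le
  have hM := hb.one_le_M
  have hxgrid := hb.norm_logBranch_sub_gridPoint_le (k := k) hl hR.le hS hx
  have hygrid := hb.norm_logBranch_sub_gridPoint_le (k := k) hl hR.le hS hy
  have hre := abs_le.1 ((Complex.abs_re_le_norm _).trans hxgrid)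
  simp only [gridPoint, Complex.sub_re] at hre
  have hgrid := hR.gridError_le
  have hnear : ‖logBranch lam C k y - logBranch lam C k x‖ ≤ (logBranch lam C k x).re := by
    rw [norm_sub_rev] at hxgrid
    linarith [norm_sub_le_norm_sub_add_norm_sub (logBranch lam C k y)
      (gridPoint (tractScale φ R) k) (logBranch lam C k x)]
  have hkoebe := h.norm_deriv_mul_norm_sub_le (hb.logBranch_re_pos hl hR hS hy)
    (z := logBranch lam C k x) (by rwa [norm_sub_rev])
  have hderiv : ‖deriv φ (gridPoint (tractScale φ R) k)‖ ≤
      ‖deriv φ (logBranch lam C k x)‖ * Real.exp (distortionConst * 2) :=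
    h.norm_deriv_le_of_norm_sub_le (hR.gridPoint_re_pos k)
      (hxgrid.trans (by simp only [gridPoint]; linarith))
  have hxy := norm_sub_le_mul_norm_logBranch_sub (k := k) hl (hS.center_ne_zero hx)
    (hS.ne_zero hx) (hS.ne_zero hy) (hS.norm_le_two_mul hx) (hS.norm_le_two_mul hy)
  calc _ ≤ (512 * Real.exp (distortionConst * 2) * (2 * M))⁻¹ *
        (‖deriv φ (logBranch lam C k x)‖ * Real.exp (distortionConst * 2) / tractScale φ R) *
        (2 * M * tractScale φ R * ‖logBranch lam C k x - logBranch lam C k y‖) := by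
        unfold gridWeight
        gcongr
    _ = ‖deriv φ (logBranch lam C k x)‖ * ‖logBranch lam C k x - logBranch lam C k y‖ / 512 := by
        field_simp
    _ ≤ ‖φ (logBranch lam C k x) - φ (logBranch lam C k y)‖ := by linarith

end TractBounds

end

/-! ### Integral means and grid sums -/

section

lemma abs_sub_two_pi_mul_round_le (x : ℝ) :
    |x - 2 * Real.pi * round (x / (2 * Real.pi))| ≤ Real.pi := by
  have hround := abs_sub_round (x / (2 * Real.pi))
  have hx : x - 2 * Real.pi * round (x / (2 * Real.pi)) =
      2 * Real.pi * (x / (2 * Real.pi) - round (x / (2 * Real.pi))) := by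
    field_simp
  rw [hx, abs_mul, abs_of_pos Real.two_pi_pos]
  nlinarith [Real.pi_pos]

open MeasureTheory in
lemma intervalIntegrable_indicator_Icc_const {a b : ℝ} (hab : a ≤ b) (c d B : ℝ) :
    IntervalIntegrable ((Icc c d).indicator fun _ => B) volume a b := by
  rw [intervalIntegrable_iff_integrableOn_Ioc_of_le hab]
  exact (integrableOn_const (by simp) (by simp)).indicator measurableSet_Icc

open MeasureTheory in
lemma intervalIntegral_indicator_Icc_const_le {a b c d B : ℝ} (hab : a ≤ b) (hcd : c ≤ d)
    (hB : 0 ≤ B) : ∫ y in a..b, (Icc c d).indicator (fun _ => B) y ≤ (d - c) * B := by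
  rw [intervalIntegral.integral_of_le hab, integral_indicator_const _ measurableSet_Icc,
    smul_eq_mul, measureReal_restrict_apply measurableSet_Icc, ← Real.volume_real_Icc_of_le hcd]
  gcongr
  · simp
  · exact inter_subset_left

/-- The indices of the grid points at height between `κR - π` and `R + π` in absolute value. -/
noncomputable def gridIndices (R : ℝ) : Finset ℤ :=
  {k ∈ Finset.Icc ⌈-(R + Real.pi)⌉ ⌊R + Real.pi⌋ |
    kappa * R - Real.pi ≤ |2 * Real.pi * k| ∧ |2 * Real.pi * k| ≤ R + Real.pi}

lemma mem_gridIndices {R : ℝ} {k : ℤ} : k ∈ gridIndices R ↔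
    kappa * R - Real.pi ≤ |2 * Real.pi * k| ∧ |2 * Real.pi * k| ≤ R + Real.pi := by
  rw [gridIndices, Finset.mem_filter, Finset.mem_Icc, Int.ceil_le, Int.le_floor, ← abs_le,
    and_iff_right_iff_imp]
  rintro ⟨-, hk⟩
  rw [abs_mul, abs_of_pos Real.two_pi_pos] at hk
  nlinarith [abs_nonneg (k : ℝ), Real.pi_gt_three]

lemma round_mem_gridIndices {R y : ℝ} (hR : 0 < R) (hy : kappa ≤ |y|) (hy' : |y| ≤ 1) :
    round (R * y / (2 * Real.pi)) ∈ gridIndices R := by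
  have hround := abs_sub_two_pi_mul_round_le (R * y)
  have habs : |R * y| = R * |y| := by rw [abs_mul, abs_of_pos hR]
  have hlow := abs_sub_abs_le_abs_sub (R * y) (2 * Real.pi * round (R * y / (2 * Real.pi)))
  have hupp := abs_sub_abs_le_abs_sub (2 * Real.pi * round (R * y / (2 * Real.pi))) (R * y)
  rw [abs_sub_comm] at hupp
  rw [mem_gridIndices]
  constructor <;> nlinarith

/-- The factor by which `gSpeed φ R` may exceed the weight of the nearest grid point: its main
part is the distortion of `φ` between the lines `Re z = 1` and `Re z = log (tractScale φ R)`. -/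
noncomputable def gridFactor (φ : ℂ → ℂ) (R : ℝ) : ℝ :=
  2 * R * (Real.log (tractScale φ R) ^ distortionConst * Real.exp (distortionConst * Real.pi))

lemma IsTractModel.gridWeight_pos {Ω : Set ℂ} {τ φ : ℂ → ℂ} {R : ℝ} (h : IsTractModel Ω τ φ)
    (hR : 0 < R) (hlog : 0 < Real.log (tractScale φ R)) (k : ℤ) : 0 < gridWeight φ R k :=
  div_pos (h.norm_deriv_pos hlog) (h.tractScale_pos hR)

namespace TractBounds

variable {Ω : Set ℂ} {τ φ : ℂ → ℂ} {M m α R₀ R t : ℝ} {k : ℤ}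

lemma gSpeed_le (hb : TractBounds φ M m α R₀) (h : IsTractModel Ω τ φ) (hR : R₀ ≤ R)
    (hlog : 1 ≤ Real.log (tractScale φ R)) {y : ℝ} (hy : |R * y - 2 * Real.pi * k| ≤ Real.pi) :
    gSpeed φ R y ≤ gridFactor φ R * gridWeight φ R k := by
  have hR0 : 0 < R := by linarith [hb.one_lt]
  have hdist := distortionConst_pos
  have hlog0 : 0 < Real.log (tractScale φ R) := by linarith
  have hderiv := h.norm_deriv_le_mul_exp (z := gridPoint (tractScale φ R) k) hlog0
    (one_add_mul_I_mem_rightHalfPlane (R * y))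
  have hre : (1 + ((R * y : ℝ) : ℂ) * Complex.I).re = 1 := by simp
  have him : (1 + ((R * y : ℝ) : ℂ) * Complex.I).im = R * y := by simp
  simp only [hre, him, gridPoint, div_one, one_div, Real.log_inv, abs_neg,
    abs_of_nonneg (Real.log_nonneg hlog)] at hderiv
  have hexp : Real.exp (distortionConst *
      (Real.log (Real.log (tractScale φ R)) + |R * y - 2 * Real.pi * k|)) ≤
      Real.log (tractScale φ R) ^ distortionConst * Real.exp (distortionConst * Real.pi) := by
    rw [Real.rpow_def_of_pos hlog0, ← Real.exp_add, Real.exp_le_exp]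
    nlinarith
  rw [gSpeed, div_le_iff₀ (hb.diam_pos hR)]
  calc R * ‖deriv φ (1 + ((R * y : ℝ) : ℂ) * Complex.I)‖
      ≤ R * (‖deriv φ (gridPoint (tractScale φ R) k)‖ * (Real.log (tractScale φ R) ^
          distortionConst * Real.exp (distortionConst * Real.pi))) := by
        gcongr
        exact hderiv.trans (mul_le_mul_of_nonneg_left hexp (norm_nonneg _))
    _ = gridFactor φ R / 2 * gridWeight φ R k * tractScale φ R := by
        have := hb.scale_pos R hR
        rw [gridWeight, gridFactor]
        field_simp
    _ ≤ gridFactor φ R / 2 * gridWeight φ R k * (2 * diamTract φ R) := by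
        have := (h.gridWeight_pos hR0 hlog0 k).le
        have : 0 ≤ gridFactor φ R := by unfold gridFactor; positivity
        gcongr
        exact hb.le_diam R hR
    _ = gridFactor φ R * gridWeight φ R k * diamTract φ R := by ring

lemma gSpeed_rpow_le_sum_indicator (hb : TractBounds φ M m α R₀) (h : IsTractModel Ω τ φ)
    (hR : R₀ ≤ R) (hlog : 1 ≤ Real.log (tractScale φ R)) (ht : 0 ≤ t) {y : ℝ}
    (hy : kappa ≤ |y|) (hy' : |y| ≤ 1) :
    gSpeed φ R y ^ t ≤ ∑ k ∈ gridIndices R,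
      (Icc ((2 * Real.pi * k - Real.pi) / R) ((2 * Real.pi * k + Real.pi) / R)).indicator
        (fun _ => (gridFactor φ R * gridWeight φ R k) ^ t) y := by
  have hR0 : 0 < R := by linarith [hb.one_lt]
  have hfactor : 0 ≤ gridFactor φ R := by unfold gridFactor; positivity
  have hspeed : 0 ≤ gSpeed φ R y := h.norm_deriv_g hR0 y ▸ norm_nonneg _
  have hround := abs_sub_two_pi_mul_round_le (R * y)
  obtain ⟨hlow, hupp⟩ := abs_le.1 hround
  refine le_trans ?_ (Finset.single_le_sum (fun k _ => indicator_nonneg (fun _ _ => ?_) y)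
    (round_mem_gridIndices hR0 hy hy'))
  · have hmem : y ∈ Icc ((2 * Real.pi * round (R * y / (2 * Real.pi)) - Real.pi) / R)
        ((2 * Real.pi * round (R * y / (2 * Real.pi)) + Real.pi) / R) :=
      ⟨by rw [div_le_iff₀ hR0]; linarith, by rw [le_div_iff₀ hR0]; linarith⟩
    rw [indicator_of_mem hmem]
    exact Real.rpow_le_rpow hspeed (hb.gSpeed_le h hR hlog hround) ht
  · have := (h.gridWeight_pos hR0 (one_pos.trans_le hlog) k).le
    positivity

lemma segMean_le_sum (hb : TractBounds φ M m α R₀) (h : IsTractModel Ω τ φ)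
    (hR : R₀ ≤ R) (hlog : 1 ≤ Real.log (tractScale φ R)) {a b : ℝ} (hab : a ≤ b)
    (hy : ∀ y ∈ Icc a b, kappa ≤ |y| ∧ |y| ≤ 1) (ht : 0 ≤ t) :
    segMean φ R t a b ≤
      2 * Real.pi / R * gridFactor φ R ^ t * ∑ k ∈ gridIndices R, gridWeight φ R k ^ t := by
  have hR0 : 0 < R := by linarith [hb.one_lt]
  have hweight k := (h.gridWeight_pos hR0 (one_pos.trans_le hlog) k).le
  have hfactor : 0 ≤ gridFactor φ R := by unfold gridFactor; positivity
  let bump (k : ℤ) : ℝ → ℝ :=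
    (Icc ((2 * Real.pi * k - Real.pi) / R) ((2 * Real.pi * k + Real.pi) / R)).indicator
      fun _ => (gridFactor φ R * gridWeight φ R k) ^ t
  have hbump : ∀ k ∈ gridIndices R, IntervalIntegrable (bump k) MeasureTheory.volume a b :=
    fun k _ => intervalIntegrable_indicator_Icc_const hab _ _ _
  rw [h.segMean_eq hR0, Finset.mul_sum]
  calc ∫ y in a..b, gSpeed φ R y ^ t
      ≤ ∫ y in a..b, ∑ k ∈ gridIndices R, bump k y :=
        intervalIntegral.integral_mono_on hab
          (((h.continuous_gSpeed R).rpow_const fun _ => Or.inr ht).intervalIntegrable _ _)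
          (by simpa only [Finset.sum_fn] using IntervalIntegrable.sum _ hbump)
          fun y hyab => hb.gSpeed_rpow_le_sum_indicator h hR hlog ht (hy y hyab).1 (hy y hyab).2
    _ = ∑ k ∈ gridIndices R, ∫ y in a..b, bump k y := intervalIntegral.integral_finsetSum hbump
    _ ≤ ∑ k ∈ gridIndices R, 2 * Real.pi / R * gridFactor φ R ^ t * gridWeight φ R k ^ t := by
        refine Finset.sum_le_sum fun k _ => (intervalIntegral_indicator_Icc_const_le hab
          (by gcongr; linarith [Real.pi_pos])
          (Real.rpow_nonneg (mul_nonneg hfactor (hweight k)) t)).trans_eq ?_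
        rw [Real.mul_rpow hfactor (hweight k)]
        ring

lemma meanI_le_sum (hb : TractBounds φ M m α R₀) (h : IsTractModel Ω τ φ)
    (hR : R₀ ≤ R) (hlog : 1 ≤ Real.log (tractScale φ R)) (ht : 0 ≤ t) :
    meanI φ R t ≤
      2 * Real.pi / R * gridFactor φ R ^ t * ∑ k ∈ gridIndices R, gridWeight φ R k ^ t := by
  have hκ := kappa_pos
  have hκ1 := kappa_lt_one
  refine max_le (hb.segMean_le_sum h hR hlog (by linarith) (fun y hy => ?_) ht)
    (hb.segMean_le_sum h hR hlog hκ1.le (fun y hy => ?_) ht)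
  · rw [abs_of_nonpos (by linarith [hy.2])]
    exact ⟨by linarith [hy.2], by linarith [hy.1]⟩
  · rw [abs_of_nonneg (by linarith [hy.1])]
    exact hy

lemma eventually_gridFactor_le (hb : TractBounds φ M m α R₀) {ε : ℝ} (hε : 0 < ε) :
    ∀ᶠ R in atTop, gridFactor φ R ≤ R ^ (1 + ε) := by
  have hdist := distortionConst_pos
  let A := 2 * (distortionConst + 2) ^ distortionConst * Real.exp (distortionConst * Real.pi)
  have hA : 0 < A := by positivity
  have hlittle := (isLittleO_log_rpow_rpow_atTop distortionConst hε).bound (inv_pos.2 hA)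
  have hlog0 : ∀ᶠ R in atTop, 0 ≤ Real.log (tractScale φ R) :=
    (Real.tendsto_log_atTop.comp hb.tendsto).eventually_ge_atTop _
  filter_upwards [hlittle, hlog0, hb.eventually_log_tractScale_le, eventually_ge_atTop 1]
    with R hR hR0 hlog hR1
  have hlogR := Real.log_nonneg hR1
  rw [Real.norm_of_nonneg (by positivity), Real.norm_of_nonneg (by positivity)] at hR
  calc gridFactor φ R ≤ 2 * R * (((distortionConst + 2) * Real.log R) ^ distortionConst *
        Real.exp (distortionConst * Real.pi)) := by
        unfold gridFactor
        gcongr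
    _ = A * Real.log R ^ distortionConst * R := by
        rw [Real.mul_rpow (by positivity) hlogR]
        ring
    _ ≤ A * (A⁻¹ * R ^ ε) * R := by gcongr
    _ = R ^ (1 + ε) := by
        rw [mul_inv_cancel_left₀ hA.ne', Real.rpow_one_add' (by positivity) (by positivity),
          mul_comm]

lemma eventually_gridFactor_rpow_le (hb : TractBounds φ M m α R₀) (ht : 0 < t) {ε : ℝ}
    (hε : 0 < ε) (K : ℝ) :
    ∀ᶠ R in atTop, 2 * Real.pi / R * gridFactor φ R ^ t * K ≤ R ^ (t - 1 + ε) := by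
  have hε' : 0 < ε / (2 * t) := by positivity
  have hconst := (tendsto_rpow_atTop (half_pos hε)).eventually_ge_atTop (2 * Real.pi * |K|)
  have hlog0 : ∀ᶠ R in atTop, 0 ≤ Real.log (tractScale φ R) :=
    (Real.tendsto_log_atTop.comp hb.tendsto).eventually_ge_atTop _
  filter_upwards [hb.eventually_gridFactor_le hε', hconst, hlog0, eventually_gt_atTop 0]
    with R hfactor hK hlog hR
  have hfactor0 : 0 ≤ gridFactor φ R := by unfold gridFactor; positivity
  calc 2 * Real.pi / R * gridFactor φ R ^ t * K
      ≤ 2 * Real.pi / R * gridFactor φ R ^ t * |K| :=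
        mul_le_mul_of_nonneg_left (le_abs_self K) (by positivity)
    _ ≤ 2 * Real.pi / R * (R ^ (1 + ε / (2 * t))) ^ t * |K| := by gcongr
    _ = 2 * Real.pi * |K| * (R ^ (t + ε / 2) / R) := by
        rw [← Real.rpow_mul hR.le, show (1 + ε / (2 * t)) * t = t + ε / 2 by field_simp]
        ring
    _ ≤ R ^ (ε / 2) * (R ^ (t + ε / 2) / R) := by gcongr
    _ = R ^ (t - 1 + ε) := by
        rw [← Real.rpow_sub_one hR.ne', ← Real.rpow_add hR]
        ring_nf

end TractBounds

end

/-! ### Repellers of large dimension -/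

section

open Metric

lemma exists_sum_lt_of_isCompact {X ι : Type*} [PseudoMetricSpace X] {K : Set X}
    (hK : IsCompact K) {ε : ℝ} (hε : 0 < ε) :
    ∃ N : ℕ, ∀ (S : Finset ι) (z : ι → X), (∀ i ∈ S, z i ∈ K) → ∀ (A : ι → ℝ) (a : ℝ),
      N * a < ∑ i ∈ S, A i →
        ∃ w ∈ K, ∃ T ⊆ S, (∀ i ∈ T, dist (z i) w < ε) ∧ a < ∑ i ∈ T, A i := by
  classical
  obtain ⟨W, hWK, hWfin, hWcover⟩ := hK.finite_cover_balls hε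
  refine ⟨hWfin.toFinset.card, fun S z hz A a ha => ?_⟩
  have hnear : ∀ i, ∃ w, i ∈ S → w ∈ hWfin.toFinset ∧ dist (z i) w < ε := by
    intro i
    by_cases hi : i ∈ S
    · simpa [hi] using hWcover (hz i hi)
    · exact ⟨z i, fun hi' => absurd hi' hi⟩
  choose w hw using hnear
  rw [← Finset.sum_fiberwise_of_maps_to (fun i hi => (hw i hi).1) A,
    ← nsmul_eq_mul, ← Finset.sum_const] at ha
  obtain ⟨v, hv, hav⟩ := Finset.exists_lt_of_sum_lt ha
  refine ⟨v, hWK (hWfin.mem_toFinset.1 hv), S.filter (w · = v), Finset.filter_subset _ _,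
    fun i hi => ?_, hav⟩
  obtain ⟨hiS, rfl⟩ := Finset.mem_filter.1 hi
  exact (hw i hiS).2

lemma isCompact_closedAnnulus (m M : ℝ) : IsCompact {w : ℂ | m ≤ ‖w‖ ∧ ‖w‖ ≤ M} :=
  (isCompact_closedBall (0 : ℂ) M).of_isClosed_subset
    ((isClosed_le continuous_const continuous_norm).inter
      (isClosed_le continuous_norm continuous_const)) fun _ hw => mem_closedBall_zero_iff.2 hw.2

namespace TractBounds

variable {Ω : Set ℂ} {τ φ f : ℂ → ℂ} {M m α R₀ lam t : ℝ}

lemma exists_isGridCluster (hb : TractBounds φ M m α R₀) :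
    ∃ N : ℕ, ∀ lam R, IsLargeScale φ M m α R₀ lam R → 8 / kappa ≤ R →
      ∀ (A : ℤ → ℝ) (a : ℝ), 0 ≤ a → N * a < ∑ k ∈ gridIndices R, A k →
        ∃ S C, IsGridCluster φ M m R S C ∧ a < ∑ k ∈ S, A k := by
  obtain ⟨N, hN⟩ := exists_sum_lt_of_isCompact (ι := ℤ) (isCompact_closedAnnulus m M)
    (div_pos hb.m_pos (by norm_num : (0 : ℝ) < 8))
  refine ⟨N, fun lam R hR hκR A a ha hsum => ?_⟩
  have hP := hb.scale_pos R hR.le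
  have hP0 : (tractScale φ R : ℂ) ≠ 0 := Complex.ofReal_ne_zero.2 hP.ne'
  have hnormP : ‖(tractScale φ R : ℂ)‖ = tractScale φ R := Complex.norm_of_nonneg hP.le
  rw [div_le_iff₀' kappa_pos] at hκR
  have hmem : ∀ k ∈ gridIndices R, φ (gridPoint (tractScale φ R) k) / tractScale φ R ∈
      {w : ℂ | m ≤ ‖w‖ ∧ ‖w‖ ≤ M} := by
    intro k hk
    obtain ⟨hlow, hupp⟩ := mem_gridIndices.1 hk
    have hQ := hR.gridPoint_mem_Q hupp
    rw [mem_ofPred_eq, norm_div, hnormP, le_div_iff₀ hP, div_le_iff₀ hP]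
    refine ⟨hb.le_norm R hR.le _ hQ ?_, hb.norm_le R hR.le _ hQ⟩
    simp only [gridPoint]
    linarith [Real.pi_le_four]
  obtain ⟨w, hw, S, hS, hdist, haS⟩ := hN _ _ hmem A a hsum
  refine ⟨S, w * tractScale φ R, ⟨?_, ?_, ?_, fun k hk => (mem_gridIndices.1 (hS hk)).2,
    fun k hk => ?_⟩, haS⟩
  · exact Finset.nonempty_of_sum_ne_zero (ha.trans_lt haS).ne'
  · rw [norm_mul, hnormP]
    exact mul_le_mul_of_nonneg_right hw.1 hP.le
  · rw [norm_mul, hnormP]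
    exact mul_le_mul_of_nonneg_right hw.2 hP.le
  · have hk' := (hdist k hk).le
    rw [dist_eq_norm, div_sub' hP0, norm_div, hnormP, div_le_iff₀ hP, mul_comm _ w] at hk'
    linarith

lemma exists_isExpandingRepeller_of_lt_sum (hb : TractBounds φ M m α R₀)
    (h : IsTractModel Ω τ φ) (hl : 0 < lam) (hf : ∀ z ∈ Ω, f z = lam * Complex.exp (τ z))
    (ht : 0 < t) : ∃ K : ℝ, ∀ R, IsLargeScale φ M m α R₀ lam R → 8 / kappa ≤ R →
      K < ∑ k ∈ gridIndices R, gridWeight φ R k ^ t →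
        ∃ X, IsExpandingRepeller f Ω X ∧ ENNReal.ofReal t ≤ dimH X := by
  have hM := hb.one_le_M
  obtain ⟨N, hN⟩ := hb.exists_isGridCluster
  set c := (512 * Real.exp (distortionConst * 2) * (2 * M))⁻¹
  have hc0 : 0 < c := by positivity
  refine ⟨N * (c ^ t)⁻¹, fun R hR hκR hsum => ?_⟩
  obtain ⟨S, C, hS, hSsum⟩ := hN lam R hR hκR _ _ (by positivity) hsum
  have hweight := h.gridWeight_pos (R := R) (by linarith [hR.le_scale]) (by linarith [hR.le_log])
  have hsys := hb.isBranchSystem h hl hf hR hS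
  refine ⟨_, hsys.isExpandingRepeller, hsys.le_dimH ht (s := fun k => c * gridWeight φ R k)
    (fun k _ => mul_pos hc0 (hweight k))
    (fun k _ x hx y hy => hb.mul_norm_sub_le_norm_comp_logBranch_sub h hl hR hS hx hy) ?_⟩
  simp only [Real.mul_rpow hc0.le (hweight _).le, ← Finset.mul_sum]
  exact ((inv_lt_iff_one_lt_mul₀' (by positivity)).1 hSsum).le

lemma frequently_lt_meanI (hb : TractBounds φ M m α R₀) (h : IsTractModel Ω τ φ) {y : ℝ}
    (ht : 0 ≤ t) (hy : (y : EReal) < betaInf φ t) : ∃ᶠ R in atTop, R ^ y < meanI φ R t := by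
  have hfr := frequently_lt_of_lt_limsup (by isBoundedDefault) hy
  refine (hfr.and_eventually ((eventually_gt_atTop 1).and (hb.eventually_meanI_pos h))).mono ?_
  rintro R ⟨hβ, hR, hpos⟩
  rw [EReal.coe_lt_coe_iff, betaR, lt_div_iff₀ (Real.log_pos hR)] at hβ
  exact (Real.rpow_lt_iff_lt_log (by linarith) (hpos t ht)).2 hβ

theorem exists_isExpandingRepeller_le_dimH (hb : TractBounds φ M m α R₀)
    (h : IsTractModel Ω τ φ) (hl : 0 < lam) (hf : ∀ z ∈ Ω, f z = lam * Complex.exp (τ z))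
    (ht : 0 < t) (hβ : ((t - 1 : ℝ) : EReal) < betaInf φ t) :
    ∃ X, IsExpandingRepeller f Ω X ∧ ENNReal.ofReal t ≤ dimH X := by
  obtain ⟨y, hty, hyβ⟩ := EReal.lt_iff_exists_real_btwn.1 hβ
  rw [EReal.coe_lt_coe_iff] at hty
  obtain ⟨K, hK⟩ := hb.exists_isExpandingRepeller_of_lt_sum h hl hf ht
  obtain ⟨R, hmean, hfactor, hlarge, hκR⟩ := ((hb.frequently_lt_meanI h ht.le hyβ).and_eventually
    ((hb.eventually_gridFactor_rpow_le ht (sub_pos.2 hty) K).and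
      ((hb.eventually_isLargeScale lam).and (eventually_ge_atTop (8 / kappa))))).exists
  have hlog := hlarge.le_log
  have hR0 : 0 < R := by linarith [hlarge.le_scale]
  have hsum := hb.meanI_le_sum h hlarge.le (by linarith) ht.le
  rw [add_sub_cancel] at hfactor
  refine hK R hlarge hκR (lt_of_mul_lt_mul_left ((hfactor.trans_lt hmean).trans_le hsum) ?_)
  have : 0 ≤ gridFactor φ R := by unfold gridFactor; positivity
  positivity

end TractBounds

end

/-! ### The zero of the spectrum -/

section

variable {Ω D D' X : Set ℂ} {τ φ f : ℂ → ℂ} {M m α R₀ t Θ : ℝ}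

lemma ofReal_le_of_forall_lt {s : ENNReal} (hΘ : 0 < Θ)
    (h : ∀ t, 0 < t → t < Θ → ENNReal.ofReal t ≤ s) : ENNReal.ofReal Θ ≤ s := by
  refine le_of_tendsto (ENNReal.continuous_ofReal.continuousWithinAt (s := Iio Θ)) ?_
  filter_upwards [Ioo_mem_nhdsLT hΘ] with t ht using h t ht.1 ht.2

lemma subset_compl_poles (hD : IsOpen D) (hf : DifferentiableOn ℂ f D) : D ⊆ (poles f)ᶜ :=
  fun _ hz => not_lt.2 (hf.analyticAt (hD.mem_nhds hz)).meromorphicOrderAt_nonneg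

lemma IsExpandingRepeller.mono (h : IsExpandingRepeller f D X) (hD : D ⊆ D') :
    IsExpandingRepeller f D' X := by
  obtain ⟨U, hU, hXU, hUD, hiso⟩ := h.isolated
  exact { h with isolated := ⟨U, hU, hXU, hUD.trans hD, hiso⟩ }

namespace TractBounds

lemma betaInf_sub_add_one (hb : TractBounds φ M m α R₀) (h : IsTractModel Ω τ φ) (ht : 0 ≤ t) :
    betaInf φ t - t + 1 = (((betaInf φ t).toReal - t + 1 : ℝ) : EReal) := by
  rw [← hb.coe_toReal_betaInf h ht]
  norm_cast

lemma toReal_betaInf_sub_add_one_bounds (hb : TractBounds φ M m α R₀) (h : IsTractModel Ω τ φ)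
    {t' : ℝ} (ht : 0 ≤ t) (htt' : t ≤ t') :
    (betaInf φ t).toReal - t + 1 - (distortionConst + 2) * (t' - t) ≤
        (betaInf φ t').toReal - t' + 1 ∧
      (betaInf φ t').toReal - t' + 1 ≤ (betaInf φ t).toReal - t + 1 - α / 2 * (t' - t) := by
  obtain ⟨hlow, hupp⟩ := hb.toReal_betaInf_bounds h ht htt'
  constructor <;> linarith

theorem existsUnique_betaInf_sub_add_one_eq_zero (hb : TractBounds φ M m α R₀)
    (h : IsTractModel Ω τ φ) : ∃! Θ : ℝ, 0 ≤ Θ ∧ betaInf φ Θ - Θ + 1 = 0 := by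
  obtain ⟨Θ, ⟨hΘ, hzero⟩, huniq⟩ := existsUnique_zero
    (b := fun t => (betaInf φ t).toReal - t + 1) (half_pos hb.alpha_pos)
    (by simp [betaInf_zero]) fun t t' => hb.toReal_betaInf_sub_add_one_bounds h
  refine ⟨Θ, ⟨hΘ, ?_⟩, fun t ht => huniq t ⟨ht.1, ?_⟩⟩
  · exact (hb.betaInf_sub_add_one h hΘ).trans (congrArg _ hzero)
  · exact_mod_cast (hb.betaInf_sub_add_one h ht.1).symm.trans ht.2

lemma coe_sub_one_lt_betaInf (hb : TractBounds φ M m α R₀) (h : IsTractModel Ω τ φ)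
    (hΘ : betaInf φ Θ - Θ + 1 = 0) (ht : 0 ≤ t) (htΘ : t < Θ) :
    ((t - 1 : ℝ) : EReal) < betaInf φ t := by
  rw [hb.betaInf_sub_add_one h (ht.trans htΘ.le), EReal.coe_eq_zero] at hΘ
  rw [← hb.coe_toReal_betaInf h ht, EReal.coe_lt_coe_iff]
  nlinarith [(hb.toReal_betaInf_sub_add_one_bounds h ht htΘ.le).2, hb.alpha_pos]

lemma one_le_of_betaInf_sub_add_one_eq_zero (hb : TractBounds φ M m α R₀)
    (h : IsTractModel Ω τ φ) (hΘ₀ : 0 ≤ Θ) (hΘ : betaInf φ Θ - Θ + 1 = 0) : 1 ≤ Θ := by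
  rw [hb.betaInf_sub_add_one h hΘ₀, EReal.coe_eq_zero] at hΘ
  by_contra! hlt
  have hβ := EReal.toReal_nonneg (hb.betaInf_one_nonneg h)
  nlinarith [(hb.toReal_betaInf_sub_add_one_bounds h hΘ₀ hlt.le).2, hb.alpha_pos]

end TractBounds

end

end HolderTract

theorem theorem4p1 (Ω : Set ℂ) (τ φ : ℂ → ℂ) (hτ : IsTractModel Ω τ φ) (hH : IsHolder φ) :
    ∃ Θ : ℝ,
      (0 ≤ Θ ∧ betaInf φ Θ - (Θ : EReal) + 1 = 0 ∧
        ∀ t : ℝ, 0 ≤ t → betaInf φ t - (t : EReal) + 1 = 0 → t = Θ) ∧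
      1 ≤ Θ ∧
      (∀ (f : ℂ → ℂ) (R : ℝ), IsTranscendentalMeromorphic f → IsLogarithmicTract f Ω R →
        (∀ z ∈ Ω, f z = (R : ℂ) * Complex.exp (τ z)) → ENNReal.ofReal Θ ≤ hypDim f) ∧
      ENNReal.ofReal Θ ≤ localHypDim (fun z => Complex.exp (τ z)) Ω := by
  obtain ⟨M, m, α, R₀, hb⟩ := hτ.exists_tractBounds hH
  obtain ⟨Θ, ⟨hΘ₀, hΘ⟩, huniq⟩ := hb.existsUnique_betaInf_sub_add_one_eq_zero hτ
  have hΘ₁ := hb.one_le_of_betaInf_sub_add_one_eq_zero hτ hΘ₀ hΘ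
  have hrepeller : ∀ (f : ℂ → ℂ) (R : ℝ), 0 < R → (∀ z ∈ Ω, f z = R * Complex.exp (τ z)) →
      ∀ t, 0 < t → t < Θ → ∃ X, IsExpandingRepeller f Ω X ∧ ENNReal.ofReal t ≤ dimH X :=
    fun f R hR hf t ht htΘ => hb.exists_isExpandingRepeller_le_dimH hτ hR hf ht
      (hb.coe_sub_one_lt_betaInf hτ hΘ ht.le htΘ)
  refine ⟨Θ, ⟨hΘ₀, hΘ, fun t ht₀ ht => huniq t ⟨ht₀, ht⟩⟩, hΘ₁, fun f R hf hR hfτ => ?_, ?_⟩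
  · refine ofReal_le_of_forall_lt (by linarith) fun t ht htΘ => ?_
    obtain ⟨X, hX, hdim⟩ := hrepeller f R hR.pos hfτ t ht htΘ
    have hpoles := subset_compl_poles hτ.isOpen ((hτ.holo.cexp.const_mul _).congr hfτ)
    exact hdim.trans (le_iSup₂_of_le X ⟨hX.mono hpoles, hX.subset_julia hf.1⟩ le_rfl)
  · refine ofReal_le_of_forall_lt (by linarith) fun t ht htΘ => ?_
    obtain ⟨X, hX, hdim⟩ := hrepeller (fun z => Complex.exp (τ z)) 1 one_pos (by simp) t ht htΘ
    exact hdim.trans (le_iSup₂_of_le X hX le_rfl)
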